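/- All algebras are complex. Let $\Omega$ be a locally compact Hausdorff space and let $\mathcal{U}=\{\Omega,(A_x)_{x\in\Omega},\Theta\}$ be a continuous field of Banach algebras: each $A_x$ is a (not necessarily unital) Banach algebra and $\Theta$ is a subalgebra of $\prod_{x}A_x$ such that (1) $\{a(x):a\in\Theta\}$ is dense in $A_x$ for every $x$; (2) $x\mapsto\|a(x)\|$ is continuous for every $a\in\Theta$; (3) if $b\in\prod_x A_x$ and for all $x\in\Omega$, $\varepsilon>0$ there is $b'\in\Theta$ with $\|b-b'\|\le\varepsilon$ throughout a neighbourhood of $x$, then $b\in\Theta$. Let $\mathfrak{A}=\{a\in\Theta:\|a(x)\|\to0 \text{ at infinity}\}$, with the norm $\|a\|=\sup_x\|a(x)\|$, be the Banach algebra defined by $\mathcal{U}$. For $Y\subseteq\Omega$ the induced field $\mathcal{U}|_Y$ has the fibres $A_x$ $(x\in Y)$, and its continuous vector fields are the $b\in\prod_{x\in Y}A_x$ such that for all $x\in Y$, $\varepsilon>0$ there is $b'\in\Theta$ with $\|b-b'\|\le\varepsilon$ throughout a neighbourhood of $x$ in $Y$. The field $\mathcal{U}$ is locally trivial if every point of $\Omega$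 has a neighbourhood $V$ such that $\mathcal{U}|_V$ is isomorphic (by fibrewise isometric algebra isomorphisms carrying the continuous vector fields onto the continuous vector fields) to the constant field over $V$ defined by some Banach algebra $B$, whose continuous vector fields are the continuous maps $V\to B$. For a Banach algebra $A$ let $A_+$ be $A$ with an identity adjoined and $\|\lambda e+a\|=|\lambda|+\|a\|$. The algebras $A_x$, $x\in\Omega$, are uniformly left projective if there are morphisms of left Banach $A_x$-modules $\rho_x:A_x\to(A_x)_+\widehat\otimes A_x$ with $\pi_x\circ\rho_x=\mathrm{id}_{A_x}$ for every $x\in\Omega$, where $\pi_x(u\otimes a)=ua$, and $\sup_x\|\rho_x\|<\infty$; they are uniformly right projective if there are morphisms of right Banach $A_x$-modules $\rho_x:A_x\to A_x\widehat\otimes(A_x)_+$ with $\pi_x\circ\rho_x=\mathrm{id}_{A_x}$ for every $x\in\Omega$, where $\pi_x(a\otimes u)=au$, and $\sup_x\|\rho_x\|<\infty$. **Proposition.** Suppose that either (a) $\mathfrak{A}$ has a right or a left bounded approximate identity (a bounded net $(e_\nu)$ with $ae_\nu\to a$ for all $a\in\mathfrak A$, respectively $e_\nu a\to a$ for all $a\in\mathfrak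 A$); or (b) $\mathcal{U}$ is locally trivial. Suppose also that the Banach algebras $A_x$, $x\in\Omega$, are not uniformly left projective or are not uniformly right projective. Then (i) there is a Banach $\mathfrak{A}$-bimodule $X$ with $\mathcal{H}^2(\mathfrak{A},X)\neq\{0\}$, where $\mathcal{H}^2(\mathfrak{A},X)$ is the second continuous Hochschild cohomology group: the bounded bilinear maps $f:\mathfrak{A}\times\mathfrak{A}\to X$ with $a\cdot f(b,c)-f(ab,c)+f(a,bc)-f(a,b)\cdot c=0$ for all $a,b,c$, modulo those of the form $f(a,b)=a\cdot g(b)-g(ab)+g(a)\cdot b$ with $g:\mathfrak{A}\to X$ bounded linear; and (ii) $\mathfrak{A}$ has a strongly unsplittable singular extension: there are a Banach algebra $\mathfrak{B}$ and a continuous surjective homomorphism $\pi:\mathfrak{B}\to\mathfrak{A}$ whose kernel $I$ satisfies $I^2=\{0\}$ and is complemented in the Banach space $\mathfrak{B}$, such that there is no continuous algebra homomorphism $\theta:\mathfrak{A}\to\mathfrak{B}$ with $\pi\circ\theta=\mathrm{id}_{\mathfrak{A}}$. -/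

import Mathlib

open Filter Topology
open scoped TensorProduct ENNReal

universe u v

set_option linter.unusedSectionVars false

noncomputable section

namespace BanachFields

/-! ### The projective tensor product of Banach spaces -/

section ProjectiveTensor

variable (E F : Type*) [NormedAddCommGroup E] [NormedSpace ℂ E]
  [NormedAddCommGroup F] [NormedSpace ℂ F]

/-- The algebraic tensor product of two normed spaces, as a carrier for the projective norm. -/
def AlgTensor := E ⊗[ℂ] F

instance : AddCommGroup (AlgTensor E F) := inferInstanceAs (AddCommGroup (E ⊗[ℂ] F))

instance : Module ℂ (AlgTensor E F) := inferInstanceAs (Module ℂ (E ⊗[ℂ] F))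

variable {E F}

/-- The elementary tensor `x ⊗ y`. -/
def algTmul (x : E) (y : F) : AlgTensor E F := x ⊗ₜ[ℂ] y

/-- The element `∑ xᵢ ⊗ yᵢ` represented by a finite list of pairs `(xᵢ, yᵢ)`. -/
def tensorOfList (l : List (E × F)) : AlgTensor E F :=
  (l.map fun p => algTmul p.1 p.2).sum

theorem tensorOfList_cons (p : E × F) (l : List (E × F)) :
    tensorOfList (p :: l) = algTmul p.1 p.2 + tensorOfList l := by
  simp [tensorOfList]

theorem tensorOfList_append (l m : List (E × F)) :
    tensorOfList (l ++ m) = tensorOfList l + tensorOfList m := by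
  simp [tensorOfList]

theorem smul_tensorOfList (c : ℂ) (l : List (E × F)) :
    c • tensorOfList l = tensorOfList (l.map fun p => (c • p.1, p.2)) := by
  induction l with
  | nil => simp [tensorOfList]
  | cons p l ih =>
    rw [tensorOfList_cons, smul_add, ih, List.map_cons, tensorOfList_cons]
    rfl

/-- The cost `∑ ‖xᵢ‖ ‖yᵢ‖` of a finite list of pairs `(xᵢ, yᵢ)`. -/
def listCost (l : List (E × F)) : ℝ := (l.map fun p => ‖p.1‖ * ‖p.2‖).sum

theorem listCost_nonneg (l : List (E × F)) : 0 ≤ listCost l := by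
  apply List.sum_nonneg
  intro r hr
  obtain ⟨p, -, rfl⟩ := List.mem_map.1 hr
  positivity

theorem exists_tensorOfList (w : AlgTensor E F) : ∃ l, tensorOfList l = w := by
  refine TensorProduct.induction_on (motive := fun w => ∃ l, tensorOfList (E := E) (F := F) l = w)
    w ⟨[], rfl⟩ (fun x y => ⟨[(x, y)], ?_⟩) ?_
  · exact (tensorOfList_cons (x, y) []).trans (add_zero _)
  · rintro a b ⟨l, rfl⟩ ⟨m, rfl⟩
    exact ⟨l ++ m, tensorOfList_append l m⟩

/-- The projective norm `inf ∑ ‖xᵢ‖ ‖yᵢ‖`, the infimum being over all finite representations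
`w = ∑ xᵢ ⊗ yᵢ`. -/
def projNorm (w : AlgTensor E F) : ℝ := sInf (listCost '' {l | tensorOfList l = w})

theorem projNorm_bddBelow (w : AlgTensor E F) :
    BddBelow (listCost '' {l : List (E × F) | tensorOfList l = w}) :=
  ⟨0, by rintro _ ⟨l, -, rfl⟩; exact listCost_nonneg l⟩

theorem projNorm_le (l : List (E × F)) : projNorm (tensorOfList l) ≤ listCost l :=
  csInf_le (projNorm_bddBelow _) ⟨l, rfl, rfl⟩

theorem projNorm_nonneg (w : AlgTensor E F) : 0 ≤ projNorm w :=
  Real.sInf_nonneg (by rintro _ ⟨l, -, rfl⟩; exact listCost_nonneg l)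

theorem exists_listCost_lt (w : AlgTensor E F) {ε : ℝ} (hε : 0 < ε) :
    ∃ l, tensorOfList l = w ∧ listCost l < projNorm w + ε := by
  obtain ⟨l₀, hl₀⟩ := exists_tensorOfList w
  obtain ⟨_, ⟨l, hl, rfl⟩, h⟩ := exists_lt_of_csInf_lt (s := listCost '' {l | tensorOfList l = w})
    ⟨_, l₀, hl₀, rfl⟩ (lt_add_of_pos_right _ hε)
  exact ⟨l, hl, h⟩

theorem projNorm_add_le (w z : AlgTensor E F) : projNorm (w + z) ≤ projNorm w + projNorm z := by
  refine le_of_forall_pos_le_add fun ε hε => ?_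
  obtain ⟨l, rfl, hl⟩ := exists_listCost_lt w (half_pos hε)
  obtain ⟨m, rfl, hm⟩ := exists_listCost_lt z (half_pos hε)
  have h' : listCost (l ++ m) = listCost l + listCost m := by simp [listCost]
  rw [← tensorOfList_append]
  linarith [projNorm_le (l ++ m)]

theorem projNorm_smul_le (c : ℂ) (w : AlgTensor E F) : projNorm (c • w) ≤ ‖c‖ * projNorm w := by
  have key : ∀ l : List (E × F), projNorm (c • tensorOfList l) ≤ ‖c‖ * listCost l := by
    intro l
    have h' : listCost (l.map fun p => (c • p.1, p.2)) = ‖c‖ * listCost l := by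
      simp [listCost, Function.comp_def, norm_smul, mul_assoc, List.sum_map_mul_left]
    rw [smul_tensorOfList, ← h']
    exact projNorm_le _
  refine le_of_forall_pos_le_add fun ε hε => ?_
  obtain ⟨l, rfl, hl⟩ := exists_listCost_lt w (ε := ε / (‖c‖ + 1)) (by positivity)
  have h1 : ‖c‖ * (ε / (‖c‖ + 1)) ≤ ε := by
    rw [mul_div_assoc', div_le_iff₀ (by positivity)]
    nlinarith [norm_nonneg c]
  nlinarith [key l, mul_le_mul_of_nonneg_left hl.le (norm_nonneg c)]

theorem projNorm_zero : projNorm (0 : AlgTensor E F) = 0 :=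
  le_antisymm (projNorm_le (E := E) (F := F) []) (projNorm_nonneg _)

variable (E F)

/-- The projective seminorm. -/
def projSeminorm : Seminorm ℂ (AlgTensor E F) :=
  Seminorm.ofSMulLE projNorm projNorm_zero projNorm_add_le projNorm_smul_le

instance : SeminormedAddCommGroup (AlgTensor E F) :=
  (projSeminorm E F).toAddGroupSeminorm.toSeminormedAddCommGroup

instance : NormedSpace ℂ (AlgTensor E F) where
  norm_smul_le c w := projNorm_smul_le c w

/-- The projective tensor product `E ⊗̂ F`: the completion of the algebraic tensor product in the
projective norm. -/
abbrev ProjTensor := UniformSpace.Completion (AlgTensor E F)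

variable {E F} {G : Type*} [NormedAddCommGroup G] [NormedSpace ℂ G]

theorem norm_algLift_le (B : E →L[ℂ] F →L[ℂ] G) (w : AlgTensor E F) :
    ‖TensorProduct.lift ((ContinuousLinearMap.coeLM ℂ).comp (B : E →ₗ[ℂ] F →L[ℂ] G)) w‖
      ≤ ‖B‖ * ‖w‖ := by
  set L := TensorProduct.lift ((ContinuousLinearMap.coeLM ℂ).comp (B : E →ₗ[ℂ] F →L[ℂ] G))
  have key : ∀ l : List (E × F), ‖L (tensorOfList l)‖ ≤ ‖B‖ * listCost l := by
    intro l
    induction l with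
    | nil =>
      have h0 : L (tensorOfList []) = 0 := map_zero L
      simp [h0, listCost]
    | cons p l ih =>
      have h1 : L (tensorOfList (p :: l)) = B p.1 p.2 + L (tensorOfList l) := by
        rw [tensorOfList_cons]
        refine (map_add L (algTmul p.1 p.2) (tensorOfList l)).trans ?_
        congr 1
      have h2 : listCost (p :: l) = ‖p.1‖ * ‖p.2‖ + listCost l := by simp [listCost]
      rw [h1, h2]
      refine (norm_add_le _ _).trans ?_
      have := B.le_opNorm₂ p.1 p.2
      nlinarith
  refine le_of_forall_pos_le_add fun ε hε => ?_
  obtain ⟨l, rfl, hl⟩ := exists_listCost_lt w (ε := ε / (‖B‖ + 1)) (by positivity)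
  have h1 : ‖B‖ * (ε / (‖B‖ + 1)) ≤ ε := by
    rw [mul_div_assoc', div_le_iff₀ (by positivity)]
    nlinarith [norm_nonneg B]
  have h2 : ‖tensorOfList l‖ = projNorm (tensorOfList l) := rfl
  rw [h2]
  nlinarith [key l, mul_le_mul_of_nonneg_left hl.le (norm_nonneg B)]

/-- The bounded linear map on the algebraic tensor product induced by a bounded bilinear map. -/
def algLift (B : E →L[ℂ] F →L[ℂ] G) : AlgTensor E F →L[ℂ] G :=
  LinearMap.mkContinuous
    (TensorProduct.lift ((ContinuousLinearMap.coeLM ℂ).comp (B : E →ₗ[ℂ] F →L[ℂ] G)) :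
      E ⊗[ℂ] F →ₗ[ℂ] G) ‖B‖ (norm_algLift_le B)

/-- The bounded linear map `E ⊗̂ F → G`, `x ⊗ y ↦ B x y`, induced by a bounded bilinear map. -/
def ProjTensor.lift [CompleteSpace G] (B : E →L[ℂ] F →L[ℂ] G) : ProjTensor E F →L[ℂ] G :=
  (algLift B).extend (UniformSpace.Completion.toComplL : AlgTensor E F →L[ℂ] ProjTensor E F)

variable (E F) in
/-- The canonical bounded bilinear map `(x, y) ↦ x ⊗ y`. -/
def ProjTensor.mk : E →L[ℂ] F →L[ℂ] ProjTensor E F :=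
  LinearMap.mkContinuous₂
    ((TensorProduct.mk ℂ E F).compr₂
      ((UniformSpace.Completion.toComplL : AlgTensor E F →L[ℂ] ProjTensor E F) :
        AlgTensor E F →ₗ[ℂ] ProjTensor E F)) 1 (by
    intro x y
    refine le_trans (le_of_eq (UniformSpace.Completion.norm_coe (algTmul x y))) ?_
    have h := projNorm_le [(x, y)]
    simp only [tensorOfList, listCost, List.map_cons, List.map_nil, List.sum_cons, List.sum_nil,
      add_zero] at h
    rw [one_mul]
    exact h)

theorem ProjTensor.lift_mk [CompleteSpace G] (B : E →L[ℂ] F →L[ℂ] G) (x : E) (y : F) :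
    ProjTensor.lift B (ProjTensor.mk E F x y) = B x y := by
  have h := ContinuousLinearMap.extend_eq (algLift B)
    (e := (UniformSpace.Completion.toComplL : AlgTensor E F →L[ℂ] ProjTensor E F))
    UniformSpace.Completion.denseRange_coe
    (UniformSpace.Completion.isUniformInducing_coe _) (algTmul x y)
  exact h

variable {E' F' : Type*} [NormedAddCommGroup E'] [NormedSpace ℂ E']
  [NormedAddCommGroup F'] [NormedSpace ℂ F']

/-- The bounded linear map `S ⊗ T : E ⊗̂ F → E' ⊗̂ F'`, `x ⊗ y ↦ S x ⊗ T y`. -/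
def ProjTensor.map (S : E →L[ℂ] E') (T : F →L[ℂ] F') : ProjTensor E F →L[ℂ] ProjTensor E' F' :=
  ProjTensor.lift ((ProjTensor.mk E' F').bilinearComp S T)

theorem ProjTensor.map_mk (S : E →L[ℂ] E') (T : F →L[ℂ] F') (x : E) (y : F) :
    ProjTensor.map S T (ProjTensor.mk E F x y) = ProjTensor.mk E' F' (S x) (T y) := by
  simp [ProjTensor.map, ProjTensor.lift_mk]

end ProjectiveTensor

/-! ### Projectivity of a Banach algebra over itself -/

section Projectivity

variable (A : Type*) [NonUnitalNormedRing A] [NormedSpace ℂ A] [IsScalarTower ℂ A A]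
  [SMulCommClass ℂ A A]

/-- The Banach algebra `A₊` obtained from `A` by adjoining an identity (whether or not `A` has one),
with the norm `‖λe + a‖ = |λ| + ‖a‖`. -/
abbrev AdjoinOne := WithLp 1 (Unitization ℂ A)

variable {A}

/-- The inclusion of `A` in `A₊`. -/
def AdjoinOne.incl (a : A) : AdjoinOne A := WithLp.toLp 1 (a : Unitization ℂ A)

variable (A)

/-- The bounded bilinear map `A₊ × A → A`, `(λe + a, x) ↦ λx + ax`. -/
def unitizationLeftMul : AdjoinOne A →L[ℂ] A →L[ℂ] A :=
  LinearMap.mkContinuous₂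
    (LinearMap.mk₂ ℂ (fun (p : AdjoinOne A) (x : A) => p.ofLp.fst • x + p.ofLp.snd * x)
      (by intro p q x; simp [add_smul, add_mul]; abel)
      (by intro c p x; simp [smul_smul, smul_add, smul_mul_assoc])
      (by intro p x y; simp [smul_add, mul_add]; abel)
      (by intro c p x; simp [smul_comm c, smul_add, mul_smul_comm])) 1 (by
    intro p x
    rw [WithLp.unitization_norm_def, one_mul, add_mul, ← norm_smul]
    exact (norm_add_le _ _).trans (add_le_add le_rfl (norm_mul_le _ _)))

/-- The bounded bilinear map `A × A₊ → A`, `(x, λe + a) ↦ λx + xa`. -/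
def unitizationRightMul : A →L[ℂ] AdjoinOne A →L[ℂ] A :=
  LinearMap.mkContinuous₂
    (LinearMap.mk₂ ℂ (fun (x : A) (p : AdjoinOne A) => p.ofLp.fst • x + x * p.ofLp.snd)
      (by intro x y p; simp [smul_add, add_mul]; abel)
      (by intro c x p; simp [smul_comm c, smul_add, smul_mul_assoc])
      (by intro x p q; simp [add_smul, mul_add]; abel)
      (by intro c x p; simp [smul_smul, smul_add, mul_smul_comm])) 1 (by
    intro x p
    rw [WithLp.unitization_norm_def, one_mul, mul_comm, add_mul, ← norm_smul]
    exact (norm_add_le _ _).trans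
      (add_le_add le_rfl ((norm_mul_le _ _).trans_eq (mul_comm _ _))))

variable {A}

/-- `ρ : A → A₊ ⊗̂ A` is a morphism of left Banach `A`-modules that is a right inverse of the
canonical morphism `π : A₊ ⊗̂ A → A`, `u ⊗ x ↦ u · x`. The left action of `a` on `A₊ ⊗̂ A` is
`a · (u ⊗ x) = au ⊗ x`. -/
structure IsLeftProjectiveSection [CompleteSpace A] (ρ : A →L[ℂ] ProjTensor (AdjoinOne A) A) :
    Prop where
  map_mul : ∀ a b : A, ρ (a * b) =
    ProjTensor.map (ContinuousLinearMap.mul ℂ (AdjoinOne A) (AdjoinOne.incl a))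
      (ContinuousLinearMap.id ℂ A) (ρ b)
  right_inv : ∀ b : A, ProjTensor.lift (unitizationLeftMul A) (ρ b) = b

/-- `ρ : A → A ⊗̂ A₊` is a morphism of right Banach `A`-modules that is a right inverse of the
canonical morphism `π : A ⊗̂ A₊ → A`, `x ⊗ u ↦ x · u`. The right action of `a` on `A ⊗̂ A₊` is
`(x ⊗ u) · a = x ⊗ ua`. -/
structure IsRightProjectiveSection [CompleteSpace A] (ρ : A →L[ℂ] ProjTensor A (AdjoinOne A)) :
    Prop where
  map_mul : ∀ b a : A, ρ (b * a) =
    ProjTensor.map (ContinuousLinearMap.id ℂ A)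
      ((ContinuousLinearMap.mul ℂ (AdjoinOne A)).flip (AdjoinOne.incl a)) (ρ b)
  right_inv : ∀ b : A, ProjTensor.lift (unitizationRightMul A) (ρ b) = b

/-- A right bounded approximate identity: a bounded net `(e_ν)` with `a e_ν → a` for all `a`. The
net is encoded by its filter of tails. -/
def HasRightBoundedApproxId (A : Type*) [NonUnitalNormedRing A] : Prop :=
  ∃ l : Filter A, l.NeBot ∧ (∃ C : ℝ, ∀ᶠ e in l, ‖e‖ ≤ C) ∧
    ∀ a : A, Tendsto (fun e => a * e) l (𝓝 a)

/-- A left bounded approximate identity: a bounded net `(e_ν)` with `e_ν a → a` for all `a`. -/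
def HasLeftBoundedApproxId (A : Type*) [NonUnitalNormedRing A] : Prop :=
  ∃ l : Filter A, l.NeBot ∧ (∃ C : ℝ, ∀ᶠ e in l, ‖e‖ ≤ C) ∧
    ∀ a : A, Tendsto (fun e => e * a) l (𝓝 a)

end Projectivity

section UniformProjectivity

variable {Ω : Type u} (A : Ω → Type v) [∀ t, NonUnitalNormedRing (A t)]
  [∀ t, NormedSpace ℂ (A t)] [∀ t, IsScalarTower ℂ (A t) (A t)]
  [∀ t, SMulCommClass ℂ (A t) (A t)] [∀ t, CompleteSpace (A t)]

/-- The Banach algebras `A t` are uniformly left projective. -/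
def UniformlyLeftProjective : Prop :=
  ∃ ρ : ∀ t, A t →L[ℂ] ProjTensor (AdjoinOne (A t)) (A t),
    (∀ t, IsLeftProjectiveSection (ρ t)) ∧ BddAbove (Set.range fun t => ‖ρ t‖)

/-- The Banach algebras `A t` are uniformly right projective. -/
def UniformlyRightProjective : Prop :=
  ∃ ρ : ∀ t, A t →L[ℂ] ProjTensor (A t) (AdjoinOne (A t)),
    (∀ t, IsRightProjectiveSection (ρ t)) ∧ BddAbove (Set.range fun t => ‖ρ t‖)

end UniformProjectivity

/-! ### Continuous fields of Banach algebras -/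

section Fields

/-- A continuous field of Banach algebras with base `Ω` and fibres `A t`; the elements of `carrier`
are the continuous vector fields. -/
structure ContinuousField (Ω : Type u) [TopologicalSpace Ω] (A : Ω → Type v)
    [∀ t, NonUnitalNormedRing (A t)] [∀ t, NormedSpace ℂ (A t)]
    extends NonUnitalSubalgebra ℂ (∀ t, A t) where
  dense' : ∀ t, Dense {a : A t | ∃ x ∈ carrier, x t = a}
  continuous_norm' : ∀ x ∈ carrier, Continuous fun t => ‖x t‖
  mem_of_local' : ∀ x : ∀ t, A t,
    (∀ t, ∀ ε > 0, ∃ x' ∈ carrier, ∀ᶠ s in 𝓝 t, ‖x s - x' s‖ ≤ ε) → x ∈ carrier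

variable {Ω : Type u} [TopologicalSpace Ω] {A : Ω → Type v}
  [∀ t, NonUnitalNormedRing (A t)] [∀ t, NormedSpace ℂ (A t)]

namespace ContinuousField

/-- A vector field `x` over `Y ⊆ Ω` is continuous at `t ∈ Y` (with respect to the field `U`). -/
def ContAt (U : ContinuousField Ω A) {Y : Set Ω} (x : ∀ t : Y, A t) (t : Y) : Prop :=
  ∀ ε > 0, ∃ x' ∈ U.carrier, ∀ᶠ s : Y in 𝓝 t, ‖x s - x' s‖ ≤ ε

theorem eventually_norm_le (U : ContinuousField Ω A) {x : ∀ t, A t} (hx : x ∈ U.carrier)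
    {Y : Set Ω} (t : Y) : ∀ᶠ s : Y in 𝓝 t, ‖x s‖ ≤ ‖x t‖ + 1 := by
  have h : Continuous fun s : Y => ‖x s‖ := (U.continuous_norm' x hx).comp continuous_subtype_val
  exact (h.continuousAt.eventually (gt_mem_nhds (lt_add_one ‖x t‖))).mono fun s hs => hs.le

theorem ContAt.mul {U : ContinuousField Ω A} {Y : Set Ω} {x y : ∀ t : Y, A t} {t : Y}
    (hx : U.ContAt x t) (hy : U.ContAt y t) : U.ContAt (x * y) t := by
  intro ε hε
  obtain ⟨y₁, hy₁, h₁⟩ := hy 1 one_pos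
  set M := ‖y₁ t‖ + 2
  have hM : 0 < M := by positivity
  obtain ⟨x', hx', h₂⟩ := hx (ε / (2 * M)) (by positivity)
  set N := ‖x' t‖ + 1
  have hN : 0 < N := by positivity
  obtain ⟨y', hy', h₃⟩ := hy (ε / (2 * N)) (by positivity)
  refine ⟨x' * y', U.mul_mem' hx' hy', ?_⟩
  filter_upwards [h₁, h₂, h₃, U.eventually_norm_le hy₁ t, U.eventually_norm_le hx' t]
    with s a₁ a₂ a₃ a₄ a₅
  have hyM : ‖y s‖ ≤ M := by
    have : ‖y s‖ ≤ ‖y s - y₁ s‖ + ‖y₁ s‖ := by simpa using norm_add_le (y s - y₁ s) (y₁ s)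
    simp only [M]; linarith
  have e : (x * y) s - (x' * y') s = (x s - x' s) * y s + x' s * (y s - y' s) := by
    simp [mul_sub, sub_mul]
  rw [e]
  calc _ ≤ ‖x s - x' s‖ * ‖y s‖ + ‖x' s‖ * ‖y s - y' s‖ :=
        (norm_add_le _ _).trans (add_le_add (norm_mul_le _ _) (norm_mul_le _ _))
    _ ≤ ε / (2 * M) * M + N * (ε / (2 * N)) := by gcongr
    _ = ε := by field_simp; norm_num

/-- The field `U|_Y` induced by `U` on a subset `Y`: its continuous vector fields are the vector
fields over `Y` that are continuous at every point of `Y`. -/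
def restrict (U : ContinuousField Ω A) (Y : Set Ω) : ContinuousField Y (fun t : Y => A t) where
  carrier := {x | ∀ t, U.ContAt x t}
  add_mem' := by
    intro x y hx hy t ε hε
    obtain ⟨x', hx', h₁⟩ := hx t (ε / 2) (half_pos hε)
    obtain ⟨y', hy', h₂⟩ := hy t (ε / 2) (half_pos hε)
    refine ⟨x' + y', U.add_mem' hx' hy', ?_⟩
    filter_upwards [h₁, h₂] with s a₁ a₂
    have e : (x + y) s - (x' + y') s = (x s - x' s) + (y s - y' s) := by
      simp only [Pi.add_apply]; abel
    rw [e]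
    linarith [norm_add_le (x s - x' s) (y s - y' s)]
  zero_mem' := fun t ε hε => ⟨0, U.zero_mem', by simp [hε.le]⟩
  mul_mem' := fun hx hy t => (hx t).mul (hy t)
  smul_mem' := by
    intro c x hx t ε hε
    obtain ⟨x', hx', h₁⟩ := hx t (ε / (‖c‖ + 1)) (by positivity)
    refine ⟨c • x', U.smul_mem' c hx', ?_⟩
    filter_upwards [h₁] with s a₁
    have e : (c • x) s - (c • x') s = c • (x s - x' s) := by simp [smul_sub]
    rw [e, norm_smul]
    calc ‖c‖ * ‖x s - x' s‖ ≤ (‖c‖ + 1) * (ε / (‖c‖ + 1)) := by gcongr; linarith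
      _ = ε := by field_simp
  dense' := fun t => (U.dense' t).mono (by
    rintro _ ⟨x, hx, rfl⟩
    exact ⟨fun s => x s, fun s ε hε => ⟨x, hx, by simp [hε.le]⟩, rfl⟩)
  continuous_norm' := by
    intro x hx
    refine continuous_iff_continuousAt.2 fun t => Metric.continuousAt_iff'.2 fun ε hε => ?_
    obtain ⟨x', hx', h₁⟩ := hx t (ε / 4) (by positivity)
    have h₂ : Continuous fun s : Y => ‖x' s‖ :=
      (U.continuous_norm' x' hx').comp continuous_subtype_val
    filter_upwards [h₁, Metric.continuousAt_iff'.1 h₂.continuousAt (ε / 4) (by positivity)]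
      with s a₁ a₂
    have a₃ := h₁.self_of_nhds
    have b₁ := (abs_le.1 ((abs_norm_sub_norm_le (x s) (x' s)).trans a₁))
    have b₃ := (abs_le.1 ((abs_norm_sub_norm_le (x t) (x' t)).trans a₃))
    rw [Real.dist_eq, abs_lt] at a₂ ⊢
    constructor <;> linarith [b₁.1, b₁.2, b₃.1, b₃.2, a₂.1, a₂.2]
  mem_of_local' := by
    intro x hx t ε hε
    obtain ⟨y, hy, h₁⟩ := hx t (ε / 2) (half_pos hε)
    obtain ⟨x', hx', h₂⟩ := hy t (ε / 2) (half_pos hε)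
    refine ⟨x', hx', ?_⟩
    filter_upwards [h₁, h₂] with s a₁ a₂
    linarith [norm_sub_le_norm_sub_add_norm_sub (x s) (y s) (x' s)]

/-- The constant field over `Ω` defined by `B`: all fibres are `B`, and the continuous vector fields
are the continuous maps `Ω → B`. -/
def const (Ω : Type u) [TopologicalSpace Ω] (B : Type v) [NonUnitalNormedRing B]
    [NormedSpace ℂ B] : ContinuousField Ω (fun _ => B) where
  carrier := {x | Continuous x}
  add_mem' := fun {_ _} (hx : Continuous _) (hy : Continuous _) => hx.add hy
  zero_mem' := show Continuous _ from continuous_const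
  mul_mem' := fun {_ _} (hx : Continuous _) (hy : Continuous _) => hx.mul hy
  smul_mem' := fun c _ (hx : Continuous _) => hx.const_smul c
  dense' := fun t => by
    have : {a : B | ∃ x ∈ {x : Ω → B | Continuous x}, x t = a} = Set.univ :=
      Set.eq_univ_of_forall fun a => ⟨fun _ => a, continuous_const, rfl⟩
    rw [this]
    exact dense_univ
  continuous_norm' := fun _ hx => Continuous.norm hx
  mem_of_local' := by
    intro x hx
    refine continuous_iff_continuousAt.2 fun t => Metric.continuousAt_iff'.2 fun ε hε => ?_
    obtain ⟨x', hx', h₁⟩ := hx t (ε / 4) (by positivity)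
    have h₂ : Continuous x' := hx'
    filter_upwards [h₁, Metric.continuousAt_iff'.1 h₂.continuousAt (ε / 4) (by positivity)]
      with s a₁ a₂
    have a₃ := h₁.self_of_nhds
    rw [← dist_eq_norm] at a₁ a₃
    rw [dist_comm] at a₃
    linarith [dist_triangle4 (x s) (x' s) (x' t) (x t)]

/-- An isomorphism of continuous fields over `Ω`: isometric algebra isomorphisms of the fibres that
carry the continuous vector fields of `U` onto those of `U'`. -/
structure Iso {A' : Ω → Type v} [∀ t, NonUnitalNormedRing (A' t)] [∀ t, NormedSpace ℂ (A' t)]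
    (U : ContinuousField Ω A) (U' : ContinuousField Ω A') where
  fibreMap : ∀ t, A t ≃ₗᵢ[ℂ] A' t
  map_mul : ∀ t (a b : A t), fibreMap t (a * b) = fibreMap t a * fibreMap t b
  mem_iff : ∀ x : ∀ t, A t, x ∈ U.carrier ↔ (fun t => fibreMap t (x t)) ∈ U'.carrier

/-- A field is trivial if it is isomorphic to the constant field of some Banach algebra. -/
def IsTrivial (U : ContinuousField Ω A) : Prop :=
  ∃ (B : Type v) (_ : NonUnitalNormedRing B) (_ : NormedSpace ℂ B) (_ : IsScalarTower ℂ B B)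
    (_ : SMulCommClass ℂ B B) (_ : CompleteSpace B), Nonempty (Iso U (const Ω B))

/-- Every point of `Ω` has a neighbourhood on which the induced field is trivial. -/
def IsLocallyTrivial (U : ContinuousField Ω A) : Prop :=
  ∀ t : Ω, ∃ V ∈ 𝓝 t, (U.restrict V).IsTrivial

/-- The continuous vector fields of `U` vanishing at infinity, as a subalgebra of the algebra of all
bounded vector fields with the supremum norm. (A continuous vector field that vanishes at infinity is
automatically bounded, see `exists_mem_sectionSubalgebra`.) -/
def sectionSubalgebra (U : ContinuousField Ω A) : NonUnitalSubalgebra ℂ (lp A ∞) where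
  carrier := {x | (x : ∀ t, A t) ∈ U.carrier ∧ Tendsto (fun t => ‖x t‖) (cocompact Ω) (𝓝 0)}
  add_mem' := by
    rintro x y ⟨hx, hx'⟩ ⟨hy, hy'⟩
    refine ⟨U.add_mem' hx hy, ?_⟩
    refine squeeze_zero (fun _ => norm_nonneg _) (fun t => norm_add_le (x t) (y t)) ?_
    simpa using hx'.add hy'
  zero_mem' := ⟨U.zero_mem', by simpa using tendsto_const_nhds⟩
  mul_mem' := by
    rintro x y ⟨hx, hx'⟩ ⟨hy, hy'⟩
    refine ⟨U.mul_mem' hx hy, ?_⟩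
    refine squeeze_zero (fun _ => norm_nonneg _) (fun t => norm_mul_le (x t) (y t)) ?_
    simpa using hx'.mul hy'
  smul_mem' := by
    rintro c x ⟨hx, hx'⟩
    refine ⟨U.smul_mem' c hx, ?_⟩
    refine squeeze_zero (fun _ => norm_nonneg _) (fun t => (norm_smul c (x t)).le) ?_
    simpa using hx'.const_mul ‖c‖

/-- The Banach algebra defined by the continuous field `U`. -/
abbrev Sections (U : ContinuousField Ω A) : Type max u v := U.sectionSubalgebra

theorem exists_mem_sectionSubalgebra (U : ContinuousField Ω A) {x : ∀ t, A t}
    (hx : x ∈ U.carrier) (h : Tendsto (fun t => ‖x t‖) (cocompact Ω) (𝓝 0)) :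
    ∃ a : U.Sections, ∀ t, (a : lp A ∞) t = x t := by
  have hb : BddAbove (Set.range fun t => ‖x t‖) := by
    obtain ⟨K, hK, hK'⟩ := mem_cocompact.1 (h.eventually (gt_mem_nhds one_pos))
    obtain ⟨C, hC⟩ := (hK.image (U.continuous_norm' x hx)).bddAbove
    refine ⟨max C 1, ?_⟩
    rintro _ ⟨t, rfl⟩
    by_cases ht : t ∈ K
    · exact le_max_of_le_left (hC ⟨t, ht, rfl⟩)
    · exact le_max_of_le_right (le_of_lt (hK' ht))
  exact ⟨⟨⟨x, memℓp_infty hb⟩, hx, h⟩, fun _ => rfl⟩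

instance (U : ContinuousField Ω A) : NormedSpace ℂ U.Sections :=
  U.sectionSubalgebra.toSubmodule.normedSpace

theorem norm_sections (U : ContinuousField Ω A) (a : U.Sections) :
    ‖a‖ = ⨆ t, ‖(a : lp A ∞) t‖ := rfl

instance (U : ContinuousField Ω A) [∀ t, CompleteSpace (A t)] : CompleteSpace U.Sections := by
  suffices h : IsClosed (U.sectionSubalgebra : Set (lp A ∞)) from h.completeSpace_coe
  refine isClosed_of_closure_subset fun x hx => ?_
  have key : ∀ ε > 0, ∃ y ∈ U.sectionSubalgebra, ∀ t, ‖x t - y t‖ ≤ ε := by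
    intro ε hε
    obtain ⟨y, hy, hxy⟩ := Metric.mem_closure_iff.1 hx ε hε
    refine ⟨y, hy, fun t => ?_⟩
    rw [dist_eq_norm] at hxy
    exact (lp.norm_apply_le_norm ENNReal.top_ne_zero (x - y) t).trans hxy.le
  refine ⟨U.mem_of_local' _ fun t ε hε => ?_, ?_⟩
  · obtain ⟨y, hy, h⟩ := key ε hε
    exact ⟨y, hy.1, Eventually.of_forall h⟩
  · refine Metric.tendsto_nhds.2 fun ε hε => ?_
    obtain ⟨y, hy, h⟩ := key (ε / 2) (half_pos hε)
    filter_upwards [hy.2.eventually (gt_mem_nhds (half_pos hε))] with t ht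
    have h1 : ‖x t‖ ≤ ‖x t - y t‖ + ‖y t‖ := by simpa using norm_add_le (x t - y t) (y t)
    rw [Real.dist_eq, sub_zero, abs_of_nonneg (norm_nonneg _)]
    linarith [h t]

end ContinuousField

end Fields

/-! ### Bimodules and the second continuous Hochschild cohomology group -/

section Cohomology

/-- A Banach `A`-bimodule structure on `X`: bounded bilinear actions `lact a x = a · x` and
`ract x a = x · a` satisfying the bimodule identities. -/
structure BanachBimodule (A : Type*) [NonUnitalNormedRing A] [NormedSpace ℂ A]
    (X : Type*) [NormedAddCommGroup X] [NormedSpace ℂ X] where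
  lact : A →L[ℂ] X →L[ℂ] X
  ract : X →L[ℂ] A →L[ℂ] X
  mul_lact : ∀ a b x, lact (a * b) x = lact a (lact b x)
  ract_mul : ∀ a b x, ract x (a * b) = ract (ract x a) b
  lact_ract : ∀ a b x, ract (lact a x) b = lact a (ract x b)

namespace BanachBimodule

variable {A : Type*} [NonUnitalNormedRing A] [NormedSpace ℂ A] [IsScalarTower ℂ A A]
  [SMulCommClass ℂ A A] {X : Type*} [NormedAddCommGroup X] [NormedSpace ℂ X]

/-- The coboundary of bounded 1-cochains: `(δ¹ g)(a, b) = a · g(b) - g(ab) + g(a) · b`. -/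
def delta1 (M : BanachBimodule A X) : (A →L[ℂ] X) →ₗ[ℂ] (A →L[ℂ] A →L[ℂ] X) where
  toFun g := ((ContinuousLinearMap.compL ℂ A X X).flip g).comp M.lact
    - (ContinuousLinearMap.compL ℂ A A X g).comp (ContinuousLinearMap.mul ℂ A) + M.ract.comp g
  map_add' g h := by ext a b; simp; abel
  map_smul' c g := by ext a b; simp [smul_sub, smul_add]

/-- The coboundary of bounded 2-cochains:
`(δ² f)(a, b, c) = a · f(b, c) - f(ab, c) + f(a, bc) - f(a, b) · c`. -/
def delta2 (M : BanachBimodule A X) :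
    (A →L[ℂ] A →L[ℂ] X) →ₗ[ℂ] (A →L[ℂ] A →L[ℂ] A →L[ℂ] X) where
  toFun f := ((ContinuousLinearMap.compL ℂ A (A →L[ℂ] X) (A →L[ℂ] X)).flip f).comp
      ((ContinuousLinearMap.compL ℂ A X X).comp M.lact)
    - (ContinuousLinearMap.compL ℂ A A (A →L[ℂ] X) f).comp (ContinuousLinearMap.mul ℂ A)
    + ((ContinuousLinearMap.compL ℂ A (A →L[ℂ] A) (A →L[ℂ] X)).flip
        (ContinuousLinearMap.mul ℂ A)).comp ((ContinuousLinearMap.compL ℂ A A X).comp f)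
    - (ContinuousLinearMap.compL ℂ A X (A →L[ℂ] X) M.ract).comp f
  map_add' f g := by ext a b c; simp; abel
  map_smul' r f := by ext a b c; simp [smul_sub, smul_add]

theorem delta1_apply (M : BanachBimodule A X) (g : A →L[ℂ] X) (a b : A) :
    M.delta1 g a b = M.lact a (g b) - g (a * b) + M.ract (g a) b := rfl

theorem delta2_apply (M : BanachBimodule A X) (f : A →L[ℂ] A →L[ℂ] X) (a b c : A) :
    M.delta2 f a b c
      = M.lact a (f b c) - f (a * b) c + f a (b * c) - M.ract (f a b) c := rfl

theorem delta2_delta1 (M : BanachBimodule A X) (g : A →L[ℂ] X) : M.delta2 (M.delta1 g) = 0 := by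
  ext a b c
  simp [delta2_apply, delta1_apply, M.mul_lact, M.ract_mul, M.lact_ract, mul_assoc]
  abel

/-- The bounded 2-cocycles `ker δ²`. -/
def Z2 (M : BanachBimodule A X) : Submodule ℂ (A →L[ℂ] A →L[ℂ] X) := LinearMap.ker M.delta2

/-- The bounded 2-coboundaries `im δ¹`, as a subspace of the 2-cocycles. -/
def B2 (M : BanachBimodule A X) : Submodule ℂ M.Z2 := (LinearMap.range M.delta1).comap M.Z2.subtype

/-- The second continuous Hochschild cohomology group `H²(A, X) = ker δ² / im δ¹`. -/
def H2 (M : BanachBimodule A X) : Type _ :=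
  @HasQuotient.Quotient M.Z2 (Submodule ℂ M.Z2)
    (@Submodule.hasQuotient ℂ M.Z2 Complex.commRing.toRing (Submodule.addCommGroup M.Z2) _) M.B2

instance (M : BanachBimodule A X) : AddCommGroup M.H2 :=
  @Submodule.Quotient.addCommGroup ℂ M.Z2 Complex.commRing.toRing (Submodule.addCommGroup M.Z2) _
    M.B2

/-- `H²(A, X) ≠ 0` exactly if some bounded 2-cocycle is not the coboundary of a bounded 1-cochain. -/
theorem nontrivial_H2_iff (M : BanachBimodule A X) :
    Nontrivial M.H2 ↔ ∃ f, M.delta2 f = 0 ∧ ∀ g, M.delta1 g ≠ f := by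
  have h : Nontrivial M.H2 ↔ M.B2 ≠ ⊤ :=
    @Submodule.Quotient.nontrivial_iff ℂ M.Z2 Complex.commRing.toRing (Submodule.addCommGroup M.Z2)
      _ M.B2
  rw [h, Ne, Submodule.eq_top_iff']
  constructor
  · intro h
    obtain ⟨f, hf⟩ := not_forall.1 h
    exact ⟨f, f.2, fun g hg => hf ⟨g, hg⟩⟩
  · rintro ⟨f, hf, hg⟩ h
    obtain ⟨g, hg'⟩ := h ⟨f, hf⟩
    exact hg g hg'

end BanachBimodule

end Cohomology

/-! ### Singular extensions -/

section Extensions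

variable {A : Type*} [NonUnitalNormedRing A] [NormedSpace ℂ A]
  {B : Type*} [NonUnitalNormedRing B] [NormedSpace ℂ B]

/-- The homomorphism `π : B → A` makes the Banach algebra `B` a singular extension of `A`: it is
continuous and onto, its kernel `I` satisfies `I² = 0`, and `I` is complemented in the Banach space
`B`, i.e. `π` has a bounded linear right inverse (admissibility). -/
structure IsSingularExtension (π : B →ₙₐ[ℂ] A) : Prop where
  continuous : Continuous π
  surjective : Function.Surjective π
  ker_mul : ∀ x y : B, π x = 0 → π y = 0 → x * y = 0
  admissible : ∃ s : A →L[ℂ] B, ∀ a, π (s a) = a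

/-- The extension `π : B → A` splits strongly: `π` has a right inverse that is a continuous algebra
homomorphism. -/
def SplitsStrongly (π : B →ₙₐ[ℂ] A) : Prop :=
  ∃ θ : A →ₙₐ[ℂ] B, Continuous θ ∧ ∀ a, π (θ a) = a

end Extensions

end BanachFields

end

open BanachFields

noncomputable section

namespace BanachFields

/-! ### Bounded maps on projective tensor products -/

section ProjectiveTensor

variable {E F G E' F' E'' F'' : Type*} [NormedAddCommGroup E] [NormedSpace ℂ E]
  [NormedAddCommGroup F] [NormedSpace ℂ F] [NormedAddCommGroup G] [NormedSpace ℂ G]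
  [NormedAddCommGroup E'] [NormedSpace ℂ E'] [NormedAddCommGroup F'] [NormedSpace ℂ F']
  [NormedAddCommGroup E''] [NormedSpace ℂ E''] [NormedAddCommGroup F''] [NormedSpace ℂ F'']

/-! The argument runs through projectivity of the section algebra R. If R is not left projective,
the canonical morphism π : R₊ ⊗̂ R → R has the bounded linear section σ(a) = 1 ⊗ a but no section
that is a module morphism. The defect a · σ(b) - σ(ab) is a 2-cocycle with values in ker π (left
action of R, zero right action). If it were δ¹g, then σ - g would be a module section. The same
space R₊ ⊗̂ R with the product w z = π(w) · z is a singular extension of R, and an algebra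
homomorphism splitting it is exactly a module section of π. The right-handed case is the mirror
image (`LeftCover.nontrivial_H2`, `LeftCover.exists_unsplittable` and their right versions).

It remains to see that a left module section ρ for R yields sections for all fibres with a common
bound. Let τ be evaluation at t and Q = τ₊ ⊗ τ. Then Q(ρ(xy)) = τ(x) · Q(ρ(y)), so Qρ kills the
closed span `kerSq τ` of products of elements of ker τ. Hence Qρ descends to the fibre as soon as τ
has a bounded right inverse that is linear and multiplicative modulo `kerSq τ` (`IsLift`,
`IsLeftProjectiveSection.exists_descend`).

Such lifts exist with constant 3 at every point, for a different reason under each hypothesis. With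
an approximate identity every section is a limit of products, which forces ker τ = `kerSq τ`; any
bounded set-theoretic right inverse then serves (`mem_kerSq_of_eval_eq_zero`). For a locally trivial
field, cut off the sections that are constant in a trivialization: this lift is exactly linear, and
its multiplicative defect is a product of two sections vanishing at t
(`exists_isLift_of_transport`). -/

theorem ProjTensor.ext {f g : ProjTensor E F →L[ℂ] G}
    (h : ∀ x y, f (ProjTensor.mk E F x y) = g (ProjTensor.mk E F x y)) : f = g := by
  ext w
  refine UniformSpace.Completion.induction_on w (isClosed_eq f.continuous g.continuous) fun z => ?_
  obtain ⟨l, rfl⟩ := exists_tensorOfList z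
  induction l with
  | nil =>
    change f ((0 : AlgTensor E F) : ProjTensor E F) = g ((0 : AlgTensor E F) : ProjTensor E F)
    rw [UniformSpace.Completion.coe_zero, map_zero, map_zero]
  | cons p l ih =>
    rw [tensorOfList_cons, UniformSpace.Completion.coe_add, map_add, map_add, ih]
    exact congrArg (· + _) (h p.1 p.2)

theorem ProjTensor.norm_mk_le (x : E) (y : F) : ‖ProjTensor.mk E F x y‖ ≤ ‖x‖ * ‖y‖ := by
  have h : ‖ProjTensor.mk E F‖ ≤ 1 := LinearMap.mkContinuous₂_norm_le _ zero_le_one _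
  calc _ ≤ ‖ProjTensor.mk E F‖ * ‖x‖ * ‖y‖ := ContinuousLinearMap.le_opNorm₂ _ _ _
    _ ≤ 1 * ‖x‖ * ‖y‖ := by gcongr
    _ = _ := by ring

/-- Numerical constants are kept explicit because π must be contractive for the extension to be a
normed ring, and the bounds on the fibres must not depend on the point. -/
theorem ProjTensor.norm_lift_apply_le [CompleteSpace G] (B : E →L[ℂ] F →L[ℂ] G) {C : ℝ}
    (hC : 0 ≤ C) (hB : ∀ x y, ‖B x y‖ ≤ C * ‖x‖ * ‖y‖) (w : ProjTensor E F) :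
    ‖ProjTensor.lift B w‖ ≤ C * ‖w‖ := by
  refine UniformSpace.Completion.induction_on w
    (isClosed_le (by fun_prop) (by fun_prop)) fun z => ?_
  have h : ProjTensor.lift B (z : ProjTensor E F) = algLift B z :=
    ContinuousLinearMap.extend_eq (algLift B)
      (e := (UniformSpace.Completion.toComplL : AlgTensor E F →L[ℂ] ProjTensor E F))
      UniformSpace.Completion.denseRange_coe
      (UniformSpace.Completion.isUniformInducing_coe _) z
  rw [h, UniformSpace.Completion.norm_coe]
  have hn : ‖algLift B z‖ ≤ ‖B‖ * ‖z‖ := norm_algLift_le B z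
  exact hn.trans (mul_le_mul_of_nonneg_right
    (ContinuousLinearMap.opNorm_le_bound₂ B hC hB) (norm_nonneg _))

theorem ProjTensor.norm_map_apply_le (S : E →L[ℂ] E') (T : F →L[ℂ] F') (w : ProjTensor E F) :
    ‖ProjTensor.map S T w‖ ≤ ‖S‖ * ‖T‖ * ‖w‖ := by
  refine ProjTensor.norm_lift_apply_le _ (by positivity) (fun x y => ?_) w
  rw [ContinuousLinearMap.bilinearComp_apply]
  calc _ ≤ ‖S x‖ * ‖T y‖ := ProjTensor.norm_mk_le _ _
    _ ≤ (‖S‖ * ‖x‖) * (‖T‖ * ‖y‖) := by gcongr <;> exact ContinuousLinearMap.le_opNorm _ _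
    _ = _ := by ring

theorem ProjTensor.map_map (S : E →L[ℂ] E') (T : F →L[ℂ] F') (S' : E' →L[ℂ] E'')
    (T' : F' →L[ℂ] F'') (w : ProjTensor E F) :
    ProjTensor.map S' T' (ProjTensor.map S T w)
      = ProjTensor.map (S'.comp S) (T'.comp T) w := by
  have h : (ProjTensor.map S' T').comp (ProjTensor.map S T)
      = ProjTensor.map (S'.comp S) (T'.comp T) :=
    ProjTensor.ext fun x y => by simp [ProjTensor.map_mk]
  exact congrArg (· w) h

theorem ProjTensor.map_add_left (S S' : E →L[ℂ] E') (T : F →L[ℂ] F') :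
    ProjTensor.map (S + S') T = ProjTensor.map S T + ProjTensor.map S' T :=
  ProjTensor.ext fun x y => by simp [ProjTensor.map_mk]

theorem ProjTensor.map_smul_left (c : ℂ) (S : E →L[ℂ] E') (T : F →L[ℂ] F') :
    ProjTensor.map (c • S) T = c • ProjTensor.map S T :=
  ProjTensor.ext fun x y => by simp [ProjTensor.map_mk]

theorem ProjTensor.map_add_right (S : E →L[ℂ] E') (T T' : F →L[ℂ] F') :
    ProjTensor.map S (T + T') = ProjTensor.map S T + ProjTensor.map S T' :=
  ProjTensor.ext fun x y => by simp [ProjTensor.map_mk]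

theorem ProjTensor.map_smul_right (c : ℂ) (S : E →L[ℂ] E') (T : F →L[ℂ] F') :
    ProjTensor.map S (c • T) = c • ProjTensor.map S T :=
  ProjTensor.ext fun x y => by simp [ProjTensor.map_mk]

end ProjectiveTensor

/-! ### Admissible covers of a Banach algebra by modules -/

section Covers

variable (A : Type u) [NonUnitalNormedRing A] [NormedSpace ℂ A] [IsScalarTower ℂ A A]
  [SMulCommClass ℂ A A] (P : Type u) [NormedAddCommGroup P] [NormedSpace ℂ P]

/-- A left Banach `A`-module `P` with a contractive module morphism `P → A` that has a bounded
linear right inverse. -/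
structure LeftCover where
  act : A →L[ℂ] P →L[ℂ] P
  proj : P →L[ℂ] A
  sec : A →L[ℂ] P
  mul_act : ∀ a b w, act (a * b) w = act a (act b w)
  proj_act : ∀ a w, proj (act a w) = a * proj w
  norm_act_le : ∀ a w, ‖act a w‖ ≤ ‖a‖ * ‖w‖
  norm_proj_le : ∀ w, ‖proj w‖ ≤ ‖w‖
  proj_sec : ∀ a, proj (sec a) = a

/-- A right Banach `A`-module `P` with a contractive module morphism `P → A` that has a bounded
linear right inverse; `act a w = w · a`. -/
structure RightCover where
  act : A →L[ℂ] P →L[ℂ] P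
  proj : P →L[ℂ] A
  sec : A →L[ℂ] P
  mul_act : ∀ a b w, act (a * b) w = act b (act a w)
  proj_act : ∀ a w, proj (act a w) = proj w * a
  norm_act_le : ∀ a w, ‖act a w‖ ≤ ‖a‖ * ‖w‖
  norm_proj_le : ∀ w, ‖proj w‖ ≤ ‖w‖
  proj_sec : ∀ a, proj (sec a) = a

variable {A P}

/-- The kernel of the projection of a left cover, with the left action of `A` and the zero right
action. -/
def LeftCover.kerBimodule (L : LeftCover A P) :
    BanachBimodule A (LinearMap.ker (L.proj : P →ₗ[ℂ] A)) where
  lact := LinearMap.mkContinuous₂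
    (LinearMap.mk₂ ℂ (fun a x => ⟨L.act a x, by
        have hx : L.proj x = 0 := x.2
        simp [L.proj_act, hx]⟩)
      (by intros; ext; simp) (by intros; ext; simp) (by intros; ext; simp)
      (by intros; ext; simp)) 1
    (by intro a x; rw [one_mul]; exact L.norm_act_le a x)
  ract := 0
  mul_lact a b x := Subtype.ext (L.mul_act a b x)
  ract_mul a b x := by simp
  lact_ract a b x := Subtype.ext (map_zero (L.act a)).symm

/-- The kernel of the projection of a right cover, with the right action of `A` and the zero left
action. -/
def RightCover.kerBimodule (L : RightCover A P) :
    BanachBimodule A (LinearMap.ker (L.proj : P →ₗ[ℂ] A)) where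
  lact := 0
  ract := LinearMap.mkContinuous₂
    (LinearMap.mk₂ ℂ (fun x a => ⟨L.act a x, by
        have hx : L.proj x = 0 := x.2
        simp [L.proj_act, hx]⟩)
      (by intros; ext; simp) (by intros; ext; simp) (by intros; ext; simp)
      (by intros; ext; simp)) 1
    (by intro x a; rw [one_mul, mul_comm]; exact L.norm_act_le a x)
  mul_lact a b x := by simp
  ract_mul a b x := Subtype.ext (L.mul_act a b x)
  lact_ract a b x := by simp

theorem LeftCover.kerBimodule_lact (L : LeftCover A P) (a : A)
    (x : LinearMap.ker (L.proj : P →ₗ[ℂ] A)) : (L.kerBimodule.lact a x : P) = L.act a x := rfl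

theorem RightCover.kerBimodule_ract (L : RightCover A P) (a : A)
    (x : LinearMap.ker (L.proj : P →ₗ[ℂ] A)) : (L.kerBimodule.ract x a : P) = L.act a x := rfl

/-- The cocycle `(a, b) ↦ a · σ(b) - σ(ab)`, where `σ` is the bounded linear section. -/
def LeftCover.cocycle (L : LeftCover A P) :
    A →L[ℂ] A →L[ℂ] LinearMap.ker (L.proj : P →ₗ[ℂ] A) :=
  LinearMap.mkContinuous₂
    (LinearMap.mk₂ ℂ (fun a b => ⟨L.act a (L.sec b) - L.sec (a * b), by
        simp [L.proj_act, L.proj_sec]⟩)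
      (by intros; ext; simp [add_mul]; abel) (by intros; ext; simp [smul_sub, smul_mul_assoc])
      (by intros; ext; simp [mul_add]; abel) (by intros; ext; simp [smul_sub, mul_smul_comm])) (2 * ‖L.sec‖) (by
    intro a b
    have h₁ : ‖L.act a (L.sec b)‖ ≤ ‖a‖ * (‖L.sec‖ * ‖b‖) := (L.norm_act_le _ _).trans
      (mul_le_mul_of_nonneg_left (L.sec.le_opNorm b) (norm_nonneg a))
    have h₂ : ‖L.sec (a * b)‖ ≤ ‖L.sec‖ * (‖a‖ * ‖b‖) := (L.sec.le_opNorm _).trans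
      (mul_le_mul_of_nonneg_left (norm_mul_le a b) (norm_nonneg _))
    refine (norm_sub_le (L.act a (L.sec b)) (L.sec (a * b))).trans ?_
    linarith)

/-- The cocycle `(a, b) ↦ σ(a) · b - σ(ab)`, where `σ` is the bounded linear section. -/
def RightCover.cocycle (L : RightCover A P) :
    A →L[ℂ] A →L[ℂ] LinearMap.ker (L.proj : P →ₗ[ℂ] A) :=
  LinearMap.mkContinuous₂
    (LinearMap.mk₂ ℂ (fun a b => ⟨L.act b (L.sec a) - L.sec (a * b), by
        simp [L.proj_act, L.proj_sec]⟩)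
      (by intros; ext; simp [add_mul]; abel) (by intros; ext; simp [smul_sub, smul_mul_assoc])
      (by intros; ext; simp [mul_add]; abel) (by intros; ext; simp [smul_sub, mul_smul_comm])) (2 * ‖L.sec‖) (by
    intro a b
    have h₁ : ‖L.act b (L.sec a)‖ ≤ ‖b‖ * (‖L.sec‖ * ‖a‖) := (L.norm_act_le _ _).trans
      (mul_le_mul_of_nonneg_left (L.sec.le_opNorm a) (norm_nonneg b))
    have h₂ : ‖L.sec (a * b)‖ ≤ ‖L.sec‖ * (‖a‖ * ‖b‖) := (L.sec.le_opNorm _).trans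
      (mul_le_mul_of_nonneg_left (norm_mul_le a b) (norm_nonneg _))
    refine (norm_sub_le (L.act b (L.sec a)) (L.sec (a * b))).trans ?_
    linarith)

theorem LeftCover.cocycle_apply (L : LeftCover A P) (a b : A) :
    (L.cocycle a b : P) = L.act a (L.sec b) - L.sec (a * b) := rfl

theorem RightCover.cocycle_apply (L : RightCover A P) (a b : A) :
    (L.cocycle a b : P) = L.act b (L.sec a) - L.sec (a * b) := rfl

/-- Since the right action is zero, δ¹g(a, b) = a · g(b) - g(ab). If this equals the cocycle of σ,
subtracting g from σ removes the failure to be a module morphism, and σ - g is still a section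
because g takes values in the kernel. -/
theorem LeftCover.nontrivial_H2 (L : LeftCover A P)
    (h : ¬ ∃ ρ : A →L[ℂ] P, (∀ a b, ρ (a * b) = L.act a (ρ b)) ∧ ∀ b, L.proj (ρ b) = b) :
    Nontrivial L.kerBimodule.H2 := by
  refine L.kerBimodule.nontrivial_H2_iff.2 ⟨L.cocycle, ?_, fun g hg => h ?_⟩
  · ext a b c
    have h0 : L.kerBimodule.ract = 0 := rfl
    simp [BanachBimodule.delta2_apply, L.kerBimodule_lact, L.cocycle_apply, L.mul_act, h0,
      mul_assoc]
  · refine ⟨L.sec - (Submodule.subtypeL _).comp g, fun a b => ?_, fun b => ?_⟩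
    · have h1 := congrArg Subtype.val (DFunLike.congr_fun (DFunLike.congr_fun hg a) b)
      have h0 : L.kerBimodule.ract = 0 := rfl
      simp [BanachBimodule.delta1_apply, L.kerBimodule_lact, L.cocycle_apply, h0] at h1
      simp only [sub_apply, ContinuousLinearMap.comp_apply,
        Submodule.subtypeL_apply, map_sub]
      rw [sub_eq_sub_iff_add_eq_add] at h1 ⊢
      rw [add_comm, h1, add_comm]
    · have h1 : L.proj (g b : P) = 0 := (g b).2
      simp [L.proj_sec, h1]

theorem RightCover.nontrivial_H2 (L : RightCover A P)
    (h : ¬ ∃ ρ : A →L[ℂ] P, (∀ a b, ρ (a * b) = L.act b (ρ a)) ∧ ∀ b, L.proj (ρ b) = b) :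
    Nontrivial L.kerBimodule.H2 := by
  refine L.kerBimodule.nontrivial_H2_iff.2 ⟨L.cocycle, ?_, fun g hg => h ?_⟩
  · ext a b c
    have h0 : L.kerBimodule.lact = 0 := rfl
    simp [BanachBimodule.delta2_apply, L.kerBimodule_ract, L.cocycle_apply, L.mul_act, h0,
      mul_assoc]
  · refine ⟨L.sec - (Submodule.subtypeL _).comp g, fun a b => ?_, fun b => ?_⟩
    · have h1 := congrArg Subtype.val (DFunLike.congr_fun (DFunLike.congr_fun hg a) b)
      have h0 : L.kerBimodule.lact = 0 := rfl
      simp [BanachBimodule.delta1_apply, L.kerBimodule_ract, L.cocycle_apply, h0] at h1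
      simp only [sub_apply, ContinuousLinearMap.comp_apply,
        Submodule.subtypeL_apply, map_sub]
      -- With zero left action the coboundary begins with -g(ab), so the order of its terms differs
      -- from the left-handed case.
      rw [neg_add_eq_sub, sub_eq_sub_iff_add_eq_add] at h1
      rw [sub_eq_sub_iff_add_eq_add, add_comm, h1, add_comm]
    · have h1 : L.proj (g b : P) = 0 := (g b).2
      simp [L.proj_sec, h1]

/-- The Banach algebra `P` with the product `w z = π(w) · z`. -/
abbrev LeftCover.ring (L : LeftCover A P) : NonUnitalNormedRing P where
  __ := ‹NormedAddCommGroup P›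
  mul w z := L.act (L.proj w) z
  left_distrib w z z' := map_add (L.act (L.proj w)) z z'
  right_distrib w w' z := show L.act (L.proj (w + w')) z = _ by rw [map_add, map_add]; rfl
  zero_mul z := show L.act (L.proj 0) z = 0 by simp
  mul_zero w := map_zero (L.act (L.proj w))
  mul_assoc w z y := by
    change L.act (L.proj (L.act (L.proj w) z)) y = L.act (L.proj w) (L.act (L.proj z) y)
    rw [L.proj_act, L.mul_act]
  -- Contractivity of both the action and the projection enters here.
  norm_mul_le w z := (L.norm_act_le _ _).trans
    (mul_le_mul_of_nonneg_right (L.norm_proj_le w) (norm_nonneg z))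

/-- The Banach algebra `P` with the product `z w = z · π(w)`. -/
abbrev RightCover.ring (L : RightCover A P) : NonUnitalNormedRing P where
  __ := ‹NormedAddCommGroup P›
  mul z w := L.act (L.proj w) z
  left_distrib z w w' := show L.act (L.proj (w + w')) z = _ by rw [map_add, map_add]; rfl
  right_distrib z z' w := map_add (L.act (L.proj w)) z z'
  zero_mul w := map_zero (L.act (L.proj w))
  mul_zero z := show L.act (L.proj 0) z = 0 by simp
  mul_assoc y z w := by
    change L.act (L.proj w) (L.act (L.proj z) y) = L.act (L.proj (L.act (L.proj w) z)) y
    rw [L.proj_act, L.mul_act]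
  norm_mul_le z w := by
    rw [mul_comm]
    exact (L.norm_act_le _ _).trans
      (mul_le_mul_of_nonneg_right (L.norm_proj_le w) (norm_nonneg z))

/-- For θ with π ∘ θ = id one has θ(a) θ(b) = π(θ(a)) · θ(b) = a · θ(b), so θ is multiplicative
exactly when it is a module morphism. The kernel squares to zero because w z depends on w only
through π(w). -/
theorem LeftCover.exists_unsplittable [CompleteSpace P] (L : LeftCover A P)
    (h : ¬ ∃ ρ : A →L[ℂ] P, (∀ a b, ρ (a * b) = L.act a (ρ b)) ∧ ∀ b, L.proj (ρ b) = b) :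
    ∃ (B : Type u) (_ : NonUnitalNormedRing B) (_ : NormedSpace ℂ B)
      (_ : IsScalarTower ℂ B B) (_ : SMulCommClass ℂ B B) (_ : CompleteSpace B)
      (π : B →ₙₐ[ℂ] A), IsSingularExtension π ∧ ¬ SplitsStrongly π := by
  -- The ring structure is built on the given normed group, so the scalar action, the norm and
  -- completeness carry over unchanged.
  let _ := L.ring
  refine ⟨P, L.ring, ‹NormedSpace ℂ P›, ⟨fun c w z => ?_⟩, ⟨fun c w z => ?_⟩, ‹CompleteSpace P›,
    { L.proj with
      map_zero' := map_zero L.proj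
      map_mul' := fun w z => L.proj_act (L.proj w) z },
    ⟨L.proj.continuous, fun a => ⟨L.sec a, L.proj_sec a⟩, fun x y hx _ => ?_,
      ⟨L.sec, L.proj_sec⟩⟩, ?_⟩
  · change L.act (L.proj (c • w)) z = c • L.act (L.proj w) z
    simp
  · exact (map_smul (L.act (L.proj w)) c z).symm
  · change L.act (L.proj x) y = 0
    rw [show L.proj x = 0 from hx]
    simp
  · rintro ⟨θ, hθ, hπ⟩
    refine h ⟨⟨⟨⟨θ, map_add θ⟩, map_smul θ⟩, hθ⟩, fun a b => ?_, hπ⟩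
    refine (map_mul θ a b).trans ?_
    change L.act (L.proj (θ a)) (θ b) = L.act a (θ b)
    rw [show L.proj (θ a) = a from hπ a]

theorem RightCover.exists_unsplittable [CompleteSpace P] (L : RightCover A P)
    (h : ¬ ∃ ρ : A →L[ℂ] P, (∀ a b, ρ (a * b) = L.act b (ρ a)) ∧ ∀ b, L.proj (ρ b) = b) :
    ∃ (B : Type u) (_ : NonUnitalNormedRing B) (_ : NormedSpace ℂ B)
      (_ : IsScalarTower ℂ B B) (_ : SMulCommClass ℂ B B) (_ : CompleteSpace B)
      (π : B →ₙₐ[ℂ] A), IsSingularExtension π ∧ ¬ SplitsStrongly π := by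
  let _ := L.ring
  refine ⟨P, L.ring, ‹NormedSpace ℂ P›, ⟨fun c w z => ?_⟩, ⟨fun c w z => ?_⟩, ‹CompleteSpace P›,
    { L.proj with
      map_zero' := map_zero L.proj
      map_mul' := fun w z => L.proj_act (L.proj z) w },
    ⟨L.proj.continuous, fun a => ⟨L.sec a, L.proj_sec a⟩, fun x y _ hy => ?_,
      ⟨L.sec, L.proj_sec⟩⟩, ?_⟩
  · exact map_smul (L.act (L.proj z)) c w
  · change c • L.act (L.proj z) w = L.act (L.proj (c • z)) w
    simp
  · change L.act (L.proj y) x = 0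
    rw [show L.proj y = 0 from hy]
    simp
  · rintro ⟨θ, hθ, hπ⟩
    refine h ⟨⟨⟨⟨θ, map_add θ⟩, map_smul θ⟩, hθ⟩, fun a b => ?_, hπ⟩
    refine (map_mul θ a b).trans ?_
    change L.act (L.proj (θ b)) (θ a) = L.act b (θ a)
    rw [show L.proj (θ b) = b from hπ b]

end Covers

/-! ### The canonical covers `A₊ ⊗̂ A` and `A ⊗̂ A₊` -/

section CanonicalCovers

variable {A : Type*} [NonUnitalNormedRing A] [NormedSpace ℂ A] [IsScalarTower ℂ A A]
  [SMulCommClass ℂ A A]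

theorem AdjoinOne.incl_add (a b : A) :
    AdjoinOne.incl (a + b) = AdjoinOne.incl a + AdjoinOne.incl b := by
  simp [AdjoinOne.incl]

theorem AdjoinOne.incl_smul (c : ℂ) (a : A) :
    AdjoinOne.incl (c • a) = c • AdjoinOne.incl a := by
  simp [AdjoinOne.incl]

theorem AdjoinOne.incl_mul (a b : A) :
    AdjoinOne.incl (a * b) = AdjoinOne.incl a * AdjoinOne.incl b := by
  simp only [AdjoinOne.incl, Unitization.inr_mul]
  rfl

theorem AdjoinOne.norm_incl (a : A) : ‖AdjoinOne.incl a‖ = ‖a‖ := WithLp.unitization_norm_inr a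

theorem unitizationLeftMul_apply (p : AdjoinOne A) (x : A) :
    unitizationLeftMul A p x = p.ofLp.fst • x + p.ofLp.snd * x := rfl

theorem unitizationRightMul_apply (x : A) (p : AdjoinOne A) :
    unitizationRightMul A x p = p.ofLp.fst • x + x * p.ofLp.snd := rfl

theorem norm_unitizationLeftMul_le (p : AdjoinOne A) (x : A) :
    ‖unitizationLeftMul A p x‖ ≤ 1 * ‖p‖ * ‖x‖ := by
  rw [unitizationLeftMul_apply, WithLp.unitization_norm_def, one_mul, add_mul, ← norm_smul]
  exact (norm_add_le _ _).trans (add_le_add le_rfl (norm_mul_le _ _))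

theorem norm_unitizationRightMul_le (x : A) (p : AdjoinOne A) :
    ‖unitizationRightMul A x p‖ ≤ 1 * ‖x‖ * ‖p‖ := by
  rw [unitizationRightMul_apply, WithLp.unitization_norm_def, one_mul, mul_comm, add_mul,
    ← norm_smul]
  exact (norm_add_le _ _).trans
    (add_le_add le_rfl ((norm_mul_le _ _).trans_eq (mul_comm _ _)))

theorem AdjoinOne.one_fst : (1 : AdjoinOne A).ofLp.fst = 1 := rfl

theorem AdjoinOne.one_snd : (1 : AdjoinOne A).ofLp.snd = 0 := rfl

theorem AdjoinOne.incl_fst (a : A) : (AdjoinOne.incl a).ofLp.fst = 0 := rfl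

theorem AdjoinOne.incl_snd (a : A) : (AdjoinOne.incl a).ofLp.snd = a := rfl

theorem norm_lift_unitizationLeftMul_le [CompleteSpace A] (w : ProjTensor (AdjoinOne A) A) :
    ‖ProjTensor.lift (unitizationLeftMul A) w‖ ≤ ‖w‖ := by
  rw [← one_mul ‖w‖]
  refine ProjTensor.norm_lift_apply_le (unitizationLeftMul A) (C := 1) zero_le_one ?_ w
  intro p x
  exact norm_unitizationLeftMul_le p x

theorem norm_lift_unitizationRightMul_le [CompleteSpace A] (w : ProjTensor A (AdjoinOne A)) :
    ‖ProjTensor.lift (unitizationRightMul A) w‖ ≤ ‖w‖ := by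
  rw [← one_mul ‖w‖]
  refine ProjTensor.norm_lift_apply_le (unitizationRightMul A) (C := 1) zero_le_one ?_ w
  intro x p
  exact norm_unitizationRightMul_le x p

theorem norm_leftAct_le (a : A) (w : ProjTensor (AdjoinOne A) A) :
    ‖ProjTensor.map (ContinuousLinearMap.mul ℂ (AdjoinOne A) (AdjoinOne.incl a))
      (ContinuousLinearMap.id ℂ A) w‖ ≤ ‖a‖ * ‖w‖ := by
  refine (ProjTensor.norm_map_apply_le _ _ _).trans ?_
  have h₁ : ‖ContinuousLinearMap.mul ℂ (AdjoinOne A) (AdjoinOne.incl a)‖ ≤ ‖a‖ :=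
    (ContinuousLinearMap.opNorm_mul_apply_le ℂ _ _).trans_eq (AdjoinOne.norm_incl a)
  have h₂ : ‖ContinuousLinearMap.id ℂ A‖ ≤ 1 := ContinuousLinearMap.norm_id_le
  calc _ ≤ ‖a‖ * 1 * ‖w‖ := by gcongr
    _ = _ := by ring

theorem norm_rightAct_le (a : A) (w : ProjTensor A (AdjoinOne A)) :
    ‖ProjTensor.map (ContinuousLinearMap.id ℂ A)
      ((ContinuousLinearMap.mul ℂ (AdjoinOne A)).flip (AdjoinOne.incl a)) w‖ ≤ ‖a‖ * ‖w‖ := by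
  refine (ProjTensor.norm_map_apply_le _ _ _).trans ?_
  have h₁ : ‖(ContinuousLinearMap.mul ℂ (AdjoinOne A)).flip (AdjoinOne.incl a)‖ ≤ ‖a‖ := by
    refine ContinuousLinearMap.opNorm_le_bound _ (norm_nonneg a) fun p => ?_
    rw [ContinuousLinearMap.flip_apply, ContinuousLinearMap.mul_apply', mul_comm ‖a‖,
      ← AdjoinOne.norm_incl a]
    exact norm_mul_le _ _
  have h₂ : ‖ContinuousLinearMap.id ℂ A‖ ≤ 1 := ContinuousLinearMap.norm_id_le
  calc _ ≤ 1 * ‖a‖ * ‖w‖ := by gcongr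
    _ = _ := by ring

end CanonicalCovers

/-! ### Module structure and linear sections of the canonical covers -/

section CanonicalCovers

variable (A : Type u) [NonUnitalNormedRing A] [NormedSpace ℂ A] [IsScalarTower ℂ A A]
  [SMulCommClass ℂ A A] [CompleteSpace A]

/-- The cover `A₊ ⊗̂ A → A`, `u ⊗ x ↦ u · x`, of left modules. -/
def leftCover : LeftCover A (ProjTensor (AdjoinOne A) A) where
  act := LinearMap.mkContinuous₂
    (LinearMap.mk₂ ℂ (fun a w => ProjTensor.map
        (ContinuousLinearMap.mul ℂ (AdjoinOne A) (AdjoinOne.incl a))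
        (ContinuousLinearMap.id ℂ A) w)
      (by intro a b w; rw [AdjoinOne.incl_add, map_add, ProjTensor.map_add_left]; rfl)
      (by intro c a w; rw [AdjoinOne.incl_smul, map_smul, ProjTensor.map_smul_left]; rfl)
      (by intros; rw [map_add]) (by intros; rw [map_smul])) 1
    (by intro a w; rw [one_mul]; exact norm_leftAct_le a w)
  proj := ProjTensor.lift (unitizationLeftMul A)
  -- The adjoined identity supplies the section a ↦ 1 ⊗ a. It is linear but need not be a module
  -- map: a · (1 ⊗ b) is a ⊗ b, not 1 ⊗ ab.
  sec := ProjTensor.mk (AdjoinOne A) A 1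
  mul_act a b w := by
    have e : ContinuousLinearMap.mul ℂ (AdjoinOne A) (AdjoinOne.incl (a * b))
        = (ContinuousLinearMap.mul ℂ (AdjoinOne A) (AdjoinOne.incl a)).comp
          (ContinuousLinearMap.mul ℂ (AdjoinOne A) (AdjoinOne.incl b)) := by
      ext p : 1
      simp [AdjoinOne.incl_mul, mul_assoc]
    change ProjTensor.map _ _ w = ProjTensor.map _ _ (ProjTensor.map _ _ w)
    rw [ProjTensor.map_map, e, ContinuousLinearMap.comp_id]
  proj_act a w := by
    have h : (ProjTensor.lift (unitizationLeftMul A)).comp (ProjTensor.map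
        (ContinuousLinearMap.mul ℂ (AdjoinOne A) (AdjoinOne.incl a)) (ContinuousLinearMap.id ℂ A))
        = (ContinuousLinearMap.mul ℂ A a).comp (ProjTensor.lift (unitizationLeftMul A)) :=
      ProjTensor.ext fun p x => by
        simp [ProjTensor.map_mk, ProjTensor.lift_mk, unitizationLeftMul_apply, AdjoinOne.incl_fst,
          AdjoinOne.incl_snd, add_mul, mul_add, mul_assoc, mul_smul_comm, smul_mul_assoc]
    exact congrArg (· w) h
  norm_act_le a w := norm_leftAct_le a w
  norm_proj_le w := norm_lift_unitizationLeftMul_le w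
  proj_sec a := by
    rw [ProjTensor.lift_mk]
    simp [unitizationLeftMul_apply, AdjoinOne.one_fst, AdjoinOne.one_snd]

/-- The cover `A ⊗̂ A₊ → A`, `x ⊗ u ↦ x · u`, of right modules. -/
def rightCover : RightCover A (ProjTensor A (AdjoinOne A)) where
  act := LinearMap.mkContinuous₂
    (LinearMap.mk₂ ℂ (fun a w => ProjTensor.map (ContinuousLinearMap.id ℂ A)
        ((ContinuousLinearMap.mul ℂ (AdjoinOne A)).flip (AdjoinOne.incl a)) w)
      (by intro a b w; rw [AdjoinOne.incl_add, map_add, ProjTensor.map_add_right]; rfl)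
      (by intro c a w; rw [AdjoinOne.incl_smul, map_smul, ProjTensor.map_smul_right]; rfl)
      (by intros; rw [map_add]) (by intros; rw [map_smul])) 1
    (by intro a w; rw [one_mul]; exact norm_rightAct_le a w)
  proj := ProjTensor.lift (unitizationRightMul A)
  sec := (ProjTensor.mk A (AdjoinOne A)).flip 1
  mul_act a b w := by
    have e : (ContinuousLinearMap.mul ℂ (AdjoinOne A)).flip (AdjoinOne.incl (a * b))
        = ((ContinuousLinearMap.mul ℂ (AdjoinOne A)).flip (AdjoinOne.incl b)).comp
          ((ContinuousLinearMap.mul ℂ (AdjoinOne A)).flip (AdjoinOne.incl a)) := by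
      ext p : 1
      simp [AdjoinOne.incl_mul, mul_assoc]
    change ProjTensor.map _ _ w = ProjTensor.map _ _ (ProjTensor.map _ _ w)
    rw [ProjTensor.map_map, e, ContinuousLinearMap.comp_id]
  proj_act a w := by
    have h : (ProjTensor.lift (unitizationRightMul A)).comp (ProjTensor.map
        (ContinuousLinearMap.id ℂ A)
        ((ContinuousLinearMap.mul ℂ (AdjoinOne A)).flip (AdjoinOne.incl a)))
        = ((ContinuousLinearMap.mul ℂ A).flip a).comp
          (ProjTensor.lift (unitizationRightMul A)) :=
      ProjTensor.ext fun x p => by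
        simp [ProjTensor.map_mk, ProjTensor.lift_mk, unitizationRightMul_apply, AdjoinOne.incl_fst,
          AdjoinOne.incl_snd, mul_add, mul_assoc, mul_smul_comm]
    exact congrArg (· w) h
  norm_act_le a w := norm_rightAct_le a w
  norm_proj_le w := norm_lift_unitizationRightMul_le w
  proj_sec a := by
    rw [ContinuousLinearMap.flip_apply, ProjTensor.lift_mk]
    simp [unitizationRightMul_apply, AdjoinOne.one_fst, AdjoinOne.one_snd]

end CanonicalCovers

/-! ### Passing from a Banach algebra to a quotient -/

section Descent

variable {R : Type*} [NonUnitalNormedRing R] [NormedSpace ℂ R] [IsScalarTower ℂ R R]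
  [SMulCommClass ℂ R R] {A : Type*} [NonUnitalNormedRing A] [NormedSpace ℂ A]
  [IsScalarTower ℂ A A] [SMulCommClass ℂ A A]

/-- The closed linear span of the products of pairs of elements of the kernel of `τ`. -/
def kerSq (τ : R →L[ℂ] A) : Submodule ℂ R :=
  (Submodule.span ℂ {z | ∃ x y, τ x = 0 ∧ τ y = 0 ∧ x * y = z}).topologicalClosure

theorem mul_mem_kerSq {τ : R →L[ℂ] A} {x y : R} (hx : τ x = 0) (hy : τ y = 0) :
    x * y ∈ kerSq τ :=
  Submodule.le_topologicalClosure _ (Submodule.subset_span ⟨x, y, hx, hy, rfl⟩)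

theorem eq_zero_of_mem_kerSq {τ : R →L[ℂ] A} {G : Type*} [NormedAddCommGroup G] [NormedSpace ℂ G]
    {T : R →L[ℂ] G} (hT : ∀ x y, τ x = 0 → τ y = 0 → T (x * y) = 0) {z : R} (hz : z ∈ kerSq τ) :
    T z = 0 := by
  have h : kerSq τ ≤ LinearMap.ker (T : R →ₗ[ℂ] G) := by
    refine Submodule.topologicalClosure_minimal _ (Submodule.span_le.2 ?_) T.isClosed_ker
    rintro _ ⟨x, y, hx, hy, rfl⟩
    exact hT x y hx hy
  exact h hz

/-- A bounded right inverse of `τ` that is linear and multiplicative modulo `kerSq τ`. -/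
structure IsLift (τ : R →L[ℂ] A) (s : A → R) (C : ℝ) : Prop where
  apply_lift : ∀ v, τ (s v) = v
  norm_le : ∀ v, ‖s v‖ ≤ C * ‖v‖
  add_mem : ∀ v w, s (v + w) - (s v + s w) ∈ kerSq τ
  smul_mem : ∀ (c : ℂ) v, s (c • v) - c • s v ∈ kerSq τ
  mul_mem : ∀ v w, s (v * w) - s v * s w ∈ kerSq τ

/-- A bounded operator vanishing on `kerSq τ` induces a bounded operator on `A`. -/
theorem IsLift.exists_descend {τ : R →L[ℂ] A} {s : A → R} {C : ℝ} (hs : IsLift τ s C)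
    {G : Type*} [NormedAddCommGroup G] [NormedSpace ℂ G] {T : R →L[ℂ] G} {M : ℝ} (hM : 0 ≤ M)
    (hC : 0 ≤ C)
    (hTM : ∀ x, ‖T x‖ ≤ M * ‖x‖) (hT : ∀ x y, τ x = 0 → τ y = 0 → T (x * y) = 0) :
    ∃ S : A →L[ℂ] G, (∀ v, S v = T (s v)) ∧ ‖S‖ ≤ M * C ∧
      ∀ v w, S (v * w) = T (s v * s w) := by
  -- The defects of s lie in `kerSq τ`, where T vanishes, so T ∘ s is genuinely linear.
  have hadd : ∀ v w, T (s (v + w)) = T (s v) + T (s w) := fun v w => by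
    have := eq_zero_of_mem_kerSq hT (hs.add_mem v w)
    rwa [map_sub, map_add, sub_eq_zero] at this
  have hsmul : ∀ (c : ℂ) v, T (s (c • v)) = c • T (s v) := fun c v => by
    have := eq_zero_of_mem_kerSq hT (hs.smul_mem c v)
    rwa [map_sub, map_smul, sub_eq_zero] at this
  have hb : ∀ v, ‖T (s v)‖ ≤ M * C * ‖v‖ := fun v => by
    rw [mul_assoc]
    exact (hTM _).trans (mul_le_mul_of_nonneg_left (hs.norm_le v) hM)
  refine ⟨LinearMap.mkContinuous ⟨⟨fun v => T (s v), hadd⟩, hsmul⟩ (M * C) hb, fun v => rfl,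
    LinearMap.mkContinuous_norm_le _ (mul_nonneg hM hC) _, fun v w => ?_⟩
  have := eq_zero_of_mem_kerSq hT (hs.mul_mem v w)
  rwa [map_sub, sub_eq_zero] at this

/-- The contractive map `R₊ → A₊` induced by a contractive map `R → A`. -/
def AdjoinOne.map (τ : R →L[ℂ] A) (hτ : ∀ x, ‖τ x‖ ≤ ‖x‖) : AdjoinOne R →L[ℂ] AdjoinOne A :=
  LinearMap.mkContinuous
    { toFun := fun p => WithLp.toLp 1
        (Unitization.inl p.ofLp.fst + (τ p.ofLp.snd : Unitization ℂ A))
      map_add' := fun p q => by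
        refine (WithLp.ofLp_injective 1) (Unitization.ext ?_ ?_) <;> simp
      map_smul' := fun c p => by
        refine (WithLp.ofLp_injective 1) (Unitization.ext ?_ ?_) <;> simp } 1 (fun p => by
    rw [one_mul, WithLp.unitization_norm_def, WithLp.unitization_norm_def]
    simpa using hτ _)

variable {τ : R →L[ℂ] A} {hτ : ∀ x, ‖τ x‖ ≤ ‖x‖}

theorem AdjoinOne.map_fst (p : AdjoinOne R) :
    (AdjoinOne.map τ hτ p).ofLp.fst = p.ofLp.fst := by
  simp [AdjoinOne.map]

theorem AdjoinOne.map_snd (p : AdjoinOne R) :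
    (AdjoinOne.map τ hτ p).ofLp.snd = τ p.ofLp.snd := by
  simp [AdjoinOne.map]

theorem AdjoinOne.norm_map_le : ‖AdjoinOne.map τ hτ‖ ≤ 1 :=
  LinearMap.mkContinuous_norm_le _ zero_le_one _

/-- Makes τ₊ ⊗ τ intertwine the left module actions over τ. -/
theorem AdjoinOne.map_incl_mul (hmul : ∀ x y, τ (x * y) = τ x * τ y) (x : R) (p : AdjoinOne R) :
    AdjoinOne.map τ hτ (AdjoinOne.incl x * p)
      = AdjoinOne.incl (τ x) * AdjoinOne.map τ hτ p := by
  refine (WithLp.ofLp_injective 1) (Unitization.ext ?_ ?_) <;>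
  simp [AdjoinOne.map_fst, AdjoinOne.map_snd, AdjoinOne.incl_fst, AdjoinOne.incl_snd, hmul]

theorem AdjoinOne.map_mul_incl (hmul : ∀ x y, τ (x * y) = τ x * τ y) (x : R) (p : AdjoinOne R) :
    AdjoinOne.map τ hτ (p * AdjoinOne.incl x)
      = AdjoinOne.map τ hτ p * AdjoinOne.incl (τ x) := by
  refine (WithLp.ofLp_injective 1) (Unitization.ext ?_ ?_) <;>
  simp [AdjoinOne.map_fst, AdjoinOne.map_snd, AdjoinOne.incl_fst, AdjoinOne.incl_snd, hmul]

variable [CompleteSpace R] [CompleteSpace A]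

/-- The contraction Q = τ₊ ⊗ τ intertwines the actions and the canonical projections of R and A.
Thus Qρ is a module map over τ, it kills products whose left factor lies in ker τ, and it can be
pushed down along s. -/
theorem IsLeftProjectiveSection.exists_descend (hτ : ∀ x, ‖τ x‖ ≤ ‖x‖)
    (hmul : ∀ x y, τ (x * y) = τ x * τ y)
    {ρ : R →L[ℂ] ProjTensor (AdjoinOne R) R} (hρ : IsLeftProjectiveSection ρ)
    {s : A → R} {C : ℝ} (hC : 0 ≤ C) (hs : IsLift τ s C) :
    ∃ ρ' : A →L[ℂ] ProjTensor (AdjoinOne A) A, IsLeftProjectiveSection ρ' ∧ ‖ρ'‖ ≤ ‖ρ‖ * C := by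
  set Q : ProjTensor (AdjoinOne R) R →L[ℂ] ProjTensor (AdjoinOne A) A :=
    ProjTensor.map (AdjoinOne.map τ hτ) τ
  have hQ : ∀ w, ‖Q w‖ ≤ ‖w‖ := fun w => by
    refine (ProjTensor.norm_map_apply_le _ _ _).trans ?_
    have h₁ : ‖AdjoinOne.map τ hτ‖ ≤ 1 := AdjoinOne.norm_map_le
    have h₂ : ‖τ‖ ≤ 1 := τ.opNorm_le_bound zero_le_one fun x => (hτ x).trans_eq (one_mul _).symm
    calc _ ≤ 1 * 1 * ‖w‖ := by gcongr
      _ = _ := by ring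
  have hact : ∀ x w, Q ((leftCover R).act x w) = (leftCover A).act (τ x) (Q w) := fun x w => by
    have e : Q.comp ((leftCover R).act x) = ((leftCover A).act (τ x)).comp Q :=
      ProjTensor.ext fun p y => by
        change ProjTensor.map (AdjoinOne.map τ hτ) τ (ProjTensor.map _ _ _)
          = ProjTensor.map _ _ (ProjTensor.map (AdjoinOne.map τ hτ) τ _)
        simp [ProjTensor.map_mk, AdjoinOne.map_incl_mul hmul]
    exact congrArg (· w) e
  have hproj : ∀ w, (leftCover A).proj (Q w) = τ ((leftCover R).proj w) := fun w => by
    have e : (leftCover A).proj.comp Q = τ.comp (leftCover R).proj :=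
      ProjTensor.ext fun p y => by
        change ProjTensor.lift _ (ProjTensor.map (AdjoinOne.map τ hτ) τ _)
          = τ (ProjTensor.lift _ _)
        simp [ProjTensor.map_mk, ProjTensor.lift_mk, unitizationLeftMul_apply, AdjoinOne.map_fst,
          AdjoinOne.map_snd, hmul]
    exact congrArg (· w) e
  have hT : ∀ x y, Q.comp ρ (x * y) = (leftCover A).act (τ x) (Q (ρ y)) := fun x y => by
    rw [ContinuousLinearMap.comp_apply, hρ.map_mul]
    exact hact x (ρ y)
  obtain ⟨S, hS, hSn, hSm⟩ := hs.exists_descend (T := Q.comp ρ) (norm_nonneg ρ) hC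
    (fun x => (hQ _).trans (ρ.le_opNorm x)) (fun x y hx _ => by
      rw [hT, hx, map_zero, zero_apply])
  refine ⟨S, ⟨fun v w => ?_, fun v => ?_⟩, hSn⟩
  -- S(vw) = Qρ(s(v) s(w)) = τ(s(v)) · Qρ(s(w)) = v · S(w).
  · rw [hSm, hT, hs.apply_lift, hS]
    rfl
  · rw [hS]
    refine (hproj (ρ (s v))).trans ?_
    exact (congrArg τ (hρ.right_inv (s v))).trans (hs.apply_lift v)

theorem IsRightProjectiveSection.exists_descend (hτ : ∀ x, ‖τ x‖ ≤ ‖x‖)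
    (hmul : ∀ x y, τ (x * y) = τ x * τ y)
    {ρ : R →L[ℂ] ProjTensor R (AdjoinOne R)} (hρ : IsRightProjectiveSection ρ)
    {s : A → R} {C : ℝ} (hC : 0 ≤ C) (hs : IsLift τ s C) :
    ∃ ρ' : A →L[ℂ] ProjTensor A (AdjoinOne A), IsRightProjectiveSection ρ' ∧ ‖ρ'‖ ≤ ‖ρ‖ * C := by
  set Q : ProjTensor R (AdjoinOne R) →L[ℂ] ProjTensor A (AdjoinOne A) :=
    ProjTensor.map τ (AdjoinOne.map τ hτ)
  have hQ : ∀ w, ‖Q w‖ ≤ ‖w‖ := fun w => by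
    refine (ProjTensor.norm_map_apply_le _ _ _).trans ?_
    have h₁ : ‖AdjoinOne.map τ hτ‖ ≤ 1 := AdjoinOne.norm_map_le
    have h₂ : ‖τ‖ ≤ 1 := τ.opNorm_le_bound zero_le_one fun x => (hτ x).trans_eq (one_mul _).symm
    calc _ ≤ 1 * 1 * ‖w‖ := by gcongr
      _ = _ := by ring
  have hact : ∀ x w, Q ((rightCover R).act x w) = (rightCover A).act (τ x) (Q w) := fun x w => by
    have e : Q.comp ((rightCover R).act x) = ((rightCover A).act (τ x)).comp Q :=
      ProjTensor.ext fun y p => by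
        change ProjTensor.map τ (AdjoinOne.map τ hτ) (ProjTensor.map _ _ _)
          = ProjTensor.map _ _ (ProjTensor.map τ (AdjoinOne.map τ hτ) _)
        simp [ProjTensor.map_mk, AdjoinOne.map_mul_incl hmul]
    exact congrArg (· w) e
  have hproj : ∀ w, (rightCover A).proj (Q w) = τ ((rightCover R).proj w) := fun w => by
    have e : (rightCover A).proj.comp Q = τ.comp (rightCover R).proj :=
      ProjTensor.ext fun y p => by
        change ProjTensor.lift _ (ProjTensor.map τ (AdjoinOne.map τ hτ) _)
          = τ (ProjTensor.lift _ _)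
        simp [ProjTensor.map_mk, ProjTensor.lift_mk, unitizationRightMul_apply, AdjoinOne.map_fst,
          AdjoinOne.map_snd, hmul]
    exact congrArg (· w) e
  have hT : ∀ x y, Q.comp ρ (x * y) = (rightCover A).act (τ y) (Q (ρ x)) := fun x y => by
    rw [ContinuousLinearMap.comp_apply, hρ.map_mul]
    exact hact y (ρ x)
  obtain ⟨S, hS, hSn, hSm⟩ := hs.exists_descend (T := Q.comp ρ) (norm_nonneg ρ) hC
    -- On this side it is the right factor whose vanishing under τ kills the product.
    (fun x => (hQ _).trans (ρ.le_opNorm x)) (fun x y _ hy => by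
      rw [hT, hy, map_zero, zero_apply])
  refine ⟨S, ⟨fun v w => ?_, fun v => ?_⟩, hSn⟩
  · rw [hSm, hT, hs.apply_lift, hS]
    rfl
  · rw [hS]
    refine (hproj (ρ (s v))).trans ?_
    exact (congrArg τ (hρ.right_inv (s v))).trans (hs.apply_lift v)

end Descent

/-! ### Sections of continuous fields -/

namespace ContinuousField

variable {Ω : Type u} [TopologicalSpace Ω] {A : Ω → Type v} [∀ t, NonUnitalNormedRing (A t)]
  [∀ t, NormedSpace ℂ (A t)]

/-- `x` can be approximated by continuous vector fields near `t`. -/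
def LocallyApprox (U : ContinuousField Ω A) (x : ∀ t, A t) (t : Ω) : Prop :=
  ∀ ε > 0, ∃ x' ∈ U.carrier, ∀ᶠ s in 𝓝 t, ‖x s - x' s‖ ≤ ε

theorem locallyApprox_of_mem (U : ContinuousField Ω A) {x : ∀ t, A t} (hx : x ∈ U.carrier)
    (t : Ω) : U.LocallyApprox x t :=
  fun ε hε => ⟨x, hx, Eventually.of_forall fun s => by simp [hε.le]⟩

/-- Near a point of the support, continuity of φ allows it to be replaced by a constant; away from
the support the product is locally zero. As x need be continuous only along the support, fields
defined near a point can be cut off to global ones. -/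
theorem smul_mem_of_locallyApprox (U : ContinuousField Ω A) {φ : Ω → ℝ} (hφ : Continuous φ)
    {x : ∀ t, A t} (hx : ∀ t ∈ tsupport φ, U.LocallyApprox x t) :
    (fun t => (φ t : ℂ) • x t) ∈ U.carrier := by
  refine U.mem_of_local' _ fun t ε hε => ?_
  by_cases ht : t ∈ tsupport φ
  · obtain ⟨x', hx', h⟩ := hx t ht (ε / (2 * (|φ t| + 1))) (by positivity)
    -- The scalar is frozen at φ(t), since only constant multiples of a continuous field are known
    -- to be continuous so far. Half of ε pays for x - x', half for φ(s) - φ(t).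
    refine ⟨(φ t : ℂ) • x', U.smul_mem' _ hx', ?_⟩
    have h₁ : ∀ᶠ s in 𝓝 t, |φ s| < |φ t| + 1 :=
      hφ.abs.continuousAt.eventually (gt_mem_nhds (lt_add_one _))
    have h₂ : ∀ᶠ s in 𝓝 t, ‖x' s‖ < ‖x' t‖ + 1 :=
      (U.continuous_norm' x' hx').continuousAt.eventually (gt_mem_nhds (lt_add_one _))
    filter_upwards [h, h₁, h₂, Metric.continuousAt_iff'.1 hφ.continuousAt
      (ε / (2 * (‖x' t‖ + 1))) (by positivity)] with s a₀ a₁ a₂ a₃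
    rw [Real.dist_eq] at a₃
    have e : (φ s : ℂ) • x s - ((φ t : ℂ) • x') s
        = (φ s : ℂ) • (x s - x' s) + ((φ s - φ t : ℝ) : ℂ) • x' s := by
      simp [smul_sub, sub_smul]
    rw [e]
    calc _ ≤ |φ s| * ‖x s - x' s‖ + |φ s - φ t| * ‖x' s‖ := by
          refine (norm_add_le _ _).trans_eq ?_
          rw [norm_smul, norm_smul, Complex.norm_real, Complex.norm_real, Real.norm_eq_abs,
            Real.norm_eq_abs]
      _ ≤ (|φ t| + 1) * (ε / (2 * (|φ t| + 1)))
          + ε / (2 * (‖x' t‖ + 1)) * (‖x' t‖ + 1) := by gcongr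
      _ = ε := by
        have p₁ : |φ t| + 1 ≠ 0 := by positivity
        have p₂ : ‖x' t‖ + 1 ≠ 0 := by positivity
        field_simp
        norm_num
  · refine ⟨0, U.zero_mem', ?_⟩
    filter_upwards [notMem_tsupport_iff_eventuallyEq.1 ht] with s hs
    simp [hs, hε.le]

theorem exists_section_of_hasCompactSupport (U : ContinuousField Ω A) {φ : Ω → ℝ}
    (hφ : Continuous φ) (hc : HasCompactSupport φ) {x : ∀ t, A t}
    (hx : ∀ t ∈ tsupport φ, U.LocallyApprox x t) :
    ∃ a : U.Sections, ∀ t, (a : lp A ∞) t = (φ t : ℂ) • x t := by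
  refine U.exists_mem_sectionSubalgebra (U.smul_mem_of_locallyApprox hφ hx) ?_
  refine Tendsto.congr' ?_ tendsto_const_nhds
  have : (tsupport φ)ᶜ ∈ cocompact Ω := IsCompact.compl_mem_cocompact hc
  filter_upwards [this] with t ht
  simp [image_eq_zero_of_notMem_tsupport ht]

theorem exists_smul_section (U : ContinuousField Ω A) {φ : Ω → ℝ} (hφ : Continuous φ)
    (hφ₀ : ∀ t, φ t ∈ Set.Icc (0 : ℝ) 1) (a : U.Sections) :
    ∃ b : U.Sections, ∀ t, (b : lp A ∞) t = (φ t : ℂ) • (a : lp A ∞) t := by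
  refine U.exists_mem_sectionSubalgebra
    (U.smul_mem_of_locallyApprox hφ fun t _ => U.locallyApprox_of_mem a.2.1 t) ?_
  refine squeeze_zero (fun _ => norm_nonneg _) (fun t => ?_) a.2.2
  rw [norm_smul, Complex.norm_real, Real.norm_of_nonneg (hφ₀ t).1]
  exact mul_le_of_le_one_left (norm_nonneg _) (hφ₀ t).2

theorem norm_apply_le (U : ContinuousField Ω A) (a : U.Sections) (t : Ω) :
    ‖(a : lp A ∞) t‖ ≤ ‖a‖ :=
  lp.norm_apply_le_norm ENNReal.top_ne_zero _ t

theorem norm_le_of_forall (U : ContinuousField Ω A) {a : U.Sections} {C : ℝ} (hC : 0 ≤ C)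
    (h : ∀ t, ‖(a : lp A ∞) t‖ ≤ C) : ‖a‖ ≤ C :=
  lp.norm_le_of_forall_le hC h

theorem sections_ext (U : ContinuousField Ω A) {a b : U.Sections}
    (h : ∀ t, (a : lp A ∞) t = (b : lp A ∞) t) : a = b :=
  Subtype.ext (lp.ext (funext h))

/-- Evaluation at `t`. -/
def eval (U : ContinuousField Ω A) (t : Ω) : U.Sections →L[ℂ] A t :=
  LinearMap.mkContinuous
    { toFun := fun a => (a : lp A ∞) t
      map_add' := fun _ _ => rfl
      map_smul' := fun _ _ => rfl } 1
    (fun a => (U.norm_apply_le a t).trans_eq (one_mul _).symm)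

theorem eval_apply (U : ContinuousField Ω A) (t : Ω) (a : U.Sections) :
    U.eval t a = (a : lp A ∞) t := rfl

theorem coe_mul_apply (U : ContinuousField Ω A) (a b : U.Sections) (t : Ω) :
    ((a * b : U.Sections) : lp A ∞) t = (a : lp A ∞) t * (b : lp A ∞) t := rfl

theorem coe_sub_apply (U : ContinuousField Ω A) (a b : U.Sections) (t : Ω) :
    ((a - b : U.Sections) : lp A ∞) t = (a : lp A ∞) t - (b : lp A ∞) t := rfl

theorem coe_add_apply (U : ContinuousField Ω A) (a b : U.Sections) (t : Ω) :
    ((a + b : U.Sections) : lp A ∞) t = (a : lp A ∞) t + (b : lp A ∞) t := rfl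

theorem coe_smul_apply (U : ContinuousField Ω A) (c : ℂ) (a : U.Sections) (t : Ω) :
    ((c • a : U.Sections) : lp A ∞) t = c • (a : lp A ∞) t := rfl

theorem norm_eval_le (U : ContinuousField Ω A) (t : Ω) (a : U.Sections) : ‖U.eval t a‖ ≤ ‖a‖ :=
  U.norm_apply_le a t

theorem eval_mul (U : ContinuousField Ω A) (t : Ω) (a b : U.Sections) :
    U.eval t (a * b) = U.eval t a * U.eval t b := rfl

/-! ### Lifting the fibres in the presence of a bounded approximate identity -/

section ApproxId

variable [LocallyCompactSpace Ω] [T2Space Ω] [∀ t, IsScalarTower ℂ (A t) (A t)]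
  [∀ t, SMulCommClass ℂ (A t) (A t)] [∀ t, CompleteSpace (A t)]

theorem exists_bump {t : Ω} {W : Set Ω} (hW : IsOpen W) (ht : t ∈ W) :
    ∃ ψ : Ω → ℝ, Continuous ψ ∧ ψ t = 1 ∧ HasCompactSupport ψ ∧ tsupport ψ ⊆ W ∧
      ∀ s, ψ s ∈ Set.Icc (0 : ℝ) 1 := by
  obtain ⟨f, h₁, h₂, h₃, h₄⟩ := exists_continuousMap_one_of_isCompact_subset_isOpen
    (isCompact_singleton (x := t)) hW (Set.singleton_subset_iff.2 ht)
  exact ⟨f, f.continuous, h₁ rfl, h₂, h₃, h₄⟩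

/-- Values of continuous fields form a dense subgroup, and a cutoff lifts each of them at the cost
of a factor 2. Completeness of the section algebra extends the lifting to the closure at the cost of
a further 1. -/
theorem eval_exists_preimage (U : ContinuousField Ω A) (t : Ω) (v : A t) :
    ∃ a : U.Sections, U.eval t a = v ∧ ‖a‖ ≤ 3 * ‖v‖ := by
  let K : AddSubgroup (A t) :=
    { carrier := {v | ∃ x ∈ U.carrier, x t = v}
      add_mem' := by
        rintro _ _ ⟨x, hx, rfl⟩ ⟨y, hy, rfl⟩
        exact ⟨x + y, U.add_mem' hx hy, rfl⟩
      zero_mem' := ⟨0, U.zero_mem', rfl⟩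
      neg_mem' := by
        rintro _ ⟨x, hx, rfl⟩
        exact ⟨(-1 : ℂ) • x, U.smul_mem' _ hx, by simp⟩ }
  let f : NormedAddGroupHom U.Sections (A t) :=
    { toFun := U.eval t
      map_add' := map_add _
      bound' := ⟨1, fun a => (U.norm_eval_le t a).trans_eq (one_mul _).symm⟩ }
  have hK : f.SurjectiveOnWith K 2 := by
    rintro _ ⟨x, hx, rfl⟩
    rcases eq_or_ne (x t) 0 with h0 | h0
    · exact ⟨0, by rw [h0]; exact map_zero _, by simp [h0]⟩
    have hpos : 0 < ‖x t‖ := norm_pos_iff.2 h0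
    -- This set contains t only because x(t) ≠ 0, hence the separate zero case.
    obtain ⟨ψ, hψ, hψt, hψc, hψs, hψI⟩ := exists_bump (t := t) (W := {s | ‖x s‖ < 2 * ‖x t‖})
      (isOpen_lt (U.continuous_norm' x hx) continuous_const)
      (by change ‖x t‖ < 2 * ‖x t‖; linarith)
    obtain ⟨a, ha⟩ := U.exists_section_of_hasCompactSupport hψ hψc
      (fun s _ => U.locallyApprox_of_mem hx s)
    refine ⟨a, ?_, U.norm_le_of_forall (by positivity) fun s => ?_⟩
    · change (a : lp A ∞) t = x t
      simp [ha, hψt]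
    · rw [ha, norm_smul, Complex.norm_real, Real.norm_of_nonneg (hψI s).1]
      by_cases hs : s ∈ tsupport ψ
      · exact (mul_le_of_le_one_left (norm_nonneg _) (hψI s).2).trans (hψs hs).le
      · rw [image_eq_zero_of_notMem_tsupport hs, zero_mul]
        positivity
  have h := controlled_closure_of_complete two_pos one_pos hK
  have hd : K.topologicalClosure = ⊤ :=
    AddSubgroup.ext fun x => ⟨fun _ => trivial, fun _ => U.dense' t x⟩
  obtain ⟨a, ha, ha'⟩ := h v (by rw [hd]; trivial)
  exact ⟨a, ha, ha'.trans_eq (by norm_num)⟩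

/-- Approximate c by xy and multiply both factors by 1 - ψ, with ψ a bump at t supported where c is
small. The new factors vanish at t, and their product is still close to c because ψ alters it only
where c is negligible. -/
theorem mem_kerSq_of_eval_eq_zero (U : ContinuousField Ω A)
    (hU : ∀ (a : U.Sections), ∀ ε > 0, ∃ x y : U.Sections, ‖a - x * y‖ < ε) {t : Ω}
    {c : U.Sections} (hc : U.eval t c = 0) : c ∈ kerSq (U.eval t) := by
  refine Metric.mem_closure_iff.2 fun ε hε => ?_
  obtain ⟨x, y, hxy⟩ := hU c (ε / 4) (by positivity)
  have hct : (c : lp A ∞) t = 0 := hc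
  obtain ⟨ψ, hψ, hψt, -, hψs, hψI⟩ := exists_bump (t := t) (W := {s | ‖(c : lp A ∞) s‖ < ε / 4})
    (isOpen_lt (U.continuous_norm' _ c.2.1) continuous_const)
    (by change ‖(c : lp A ∞) t‖ < ε / 4; rw [hct, norm_zero]; positivity)
  have hχ : Continuous fun s => 1 - ψ s := by fun_prop
  have hχI : ∀ s, 1 - ψ s ∈ Set.Icc (0 : ℝ) 1 := fun s =>
    ⟨by linarith [(hψI s).2], by linarith [(hψI s).1]⟩
  obtain ⟨x', hx'⟩ := U.exists_smul_section hχ hχI x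
  obtain ⟨y', hy'⟩ := U.exists_smul_section hχ hχI y
  refine ⟨x' * y', Submodule.subset_span ⟨x', y', ?_, ?_, rfl⟩, ?_⟩
  · rw [eval_apply, hx', hψt]; simp
  · rw [eval_apply, hy', hψt]; simp
  rw [dist_eq_norm]
  refine lt_of_le_of_lt (U.norm_le_of_forall (C := ε / 2) (by positivity) fun s => ?_)
    (half_lt_self hε)
  set q : ℝ := (1 - ψ s) * (1 - ψ s) with hq
  have hq₀ : 0 ≤ q := mul_nonneg (hχI s).1 (hχI s).1
  have hq₁ : q ≤ 1 := mul_le_one₀ (hχI s).2 (hχI s).1 (hχI s).2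
  -- With q = (1 - ψ)², the error is a convex combination of c and c - xy. The weight 1 - q of c
  -- vanishes off the support of ψ.
  have e : ((c - x' * y' : U.Sections) : lp A ∞) s
      = ((1 - q : ℝ) : ℂ) • (c : lp A ∞) s
        + (q : ℂ) • ((c - x * y : U.Sections) : lp A ∞) s := by
    rw [U.coe_sub_apply, U.coe_sub_apply, U.coe_mul_apply, U.coe_mul_apply, hx', hy', smul_mul_smul_comm,
      ← Complex.ofReal_mul, ← hq, Complex.ofReal_sub, Complex.ofReal_one, sub_smul, one_smul,
      smul_sub]
    abel
  have h₁ : ‖((1 - q : ℝ) : ℂ) • (c : lp A ∞) s‖ ≤ ε / 4 := by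
    rw [norm_smul, Complex.norm_real, Real.norm_of_nonneg (by linarith)]
    by_cases hs : s ∈ tsupport ψ
    · exact (mul_le_of_le_one_left (norm_nonneg _) (by linarith)).trans (hψs hs).le
    · rw [hq, image_eq_zero_of_notMem_tsupport hs]
      norm_num
      positivity
  have h₂ : ‖(q : ℂ) • ((c - x * y : U.Sections) : lp A ∞) s‖ ≤ ε / 4 := by
    rw [norm_smul, Complex.norm_real, Real.norm_of_nonneg hq₀]
    exact (mul_le_of_le_one_left (norm_nonneg _) hq₁).trans
      ((U.norm_apply_le _ s).trans hxy.le)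
  rw [e]
  linarith [norm_add_le (((1 - q : ℝ) : ℂ) • (c : lp A ∞) s)
    ((q : ℂ) • ((c - x * y : U.Sections) : lp A ∞) s)]

/-- Any choice of bounded preimages works: its linear and multiplicative defects evaluate to zero at
t, so they lie in `kerSq`. -/
theorem exists_isLift_of_products_dense (U : ContinuousField Ω A)
    (hU : ∀ (a : U.Sections), ∀ ε > 0, ∃ x y : U.Sections, ‖a - x * y‖ < ε) (t : Ω) :
    ∃ s, IsLift (U.eval t) s 3 := by
  choose s hs hn using U.eval_exists_preimage t
  refine ⟨s, hs, hn, fun v w => ?_, fun c v => ?_, fun v w => ?_⟩ <;>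
  refine U.mem_kerSq_of_eval_eq_zero hU ?_
  · simp [hs]
  · simp [hs]
  · simp [hs, eval_mul]

end ApproxId

/-! ### Lifting the fibres of a locally trivial field -/

section LocallyTrivial

variable [LocallyCompactSpace Ω] [T2Space Ω] [∀ t, IsScalarTower ℂ (A t) (A t)]
  [∀ t, SMulCommClass ℂ (A t) (A t)] [∀ t, CompleteSpace (A t)]

/-- Here T extends each vector at t to a field, multiplicatively in the vector. The lift v ↦ ψ T(v)
is linear, and its multiplicative defect (ψ - ψ²) T(v) T(w) splits symmetrically as the product of
√(ψ - ψ²) T(v) and √(ψ - ψ²) T(w), which vanish at t because ψ(t) = 1. -/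
theorem exists_isLift_of_transport (U : ContinuousField Ω A) {t : Ω} {W : Set Ω}
    (hW : W ∈ 𝓝 t) (T : A t → ∀ s, A s) (hT : ∀ v, T v t = v) (hn : ∀ v s, ‖T v s‖ ≤ ‖v‖)
    (hadd : ∀ v w s, T (v + w) s = T v s + T w s) (hsmul : ∀ (c : ℂ) v s, T (c • v) s = c • T v s)
    (hmul : ∀ v w s, T (v * w) s = T v s * T w s) (hloc : ∀ v, ∀ s ∈ W, U.LocallyApprox (T v) s) :
    ∃ s, IsLift (U.eval t) s 3 := by
  obtain ⟨ψ, hψ, hψt, hψc, hψs, hψI⟩ := exists_bump isOpen_interior (mem_interior_iff_mem_nhds.2 hW)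
  set η : Ω → ℝ := fun s => √(ψ s - ψ s * ψ s) with hη
  have hη₀ : ∀ s, ψ s = 0 → η s = 0 := fun s hs => by simp [hη, hs]
  have hηc : HasCompactSupport η := hψc.mono fun s hs h => hs (hη₀ s h)
  have hηs : tsupport η ⊆ tsupport ψ := closure_mono fun s hs h => hs (hη₀ s h)
  have hηη : ∀ s, η s * η s = ψ s - ψ s * ψ s := fun s =>
    Real.mul_self_sqrt (by nlinarith [(hψI s).1, (hψI s).2])
  choose p hp using fun v => U.exists_section_of_hasCompactSupport hψ hψc
    (x := T v) (fun s hs => hloc v s (interior_subset (hψs hs)))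
  choose q hq using fun v => U.exists_section_of_hasCompactSupport
    (φ := η) (by fun_prop) hηc (x := T v) (fun s hs => hloc v s (interior_subset (hψs (hηs hs))))
  refine ⟨p, fun v => ?_, fun v => ?_, fun v w => ?_, fun c v => ?_, fun v w => ?_⟩
  · simp [eval_apply, hp, hψt, hT]
  · refine U.norm_le_of_forall (by positivity) fun s => ?_
    rw [hp, norm_smul, Complex.norm_real, Real.norm_of_nonneg (hψI s).1]
    have := mul_le_of_le_one_left (norm_nonneg (T v s)) (hψI s).2
    -- The bound holds already with constant 1; 3 is taken to agree with the lifts built from dense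
    -- products.
    linarith [hn v s, norm_nonneg v]
  · have e : p (v + w) - (p v + p w) = 0 := U.sections_ext fun s => by
      rw [U.coe_sub_apply, U.coe_add_apply, hp, hp, hp, hadd, smul_add, sub_self]
      rfl
    rw [e]
    exact zero_mem _
  · have e : p (c • v) - c • p v = 0 := U.sections_ext fun s => by
      rw [U.coe_sub_apply, U.coe_smul_apply, hp, hp, hsmul, smul_comm, sub_self]
      rfl
    rw [e]
    exact zero_mem _
  · have e : p (v * w) - p v * p w = q v * q w := U.sections_ext fun s => by
      rw [U.coe_sub_apply, U.coe_mul_apply, U.coe_mul_apply, hp, hp, hp, hq, hq, hmul]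
      simp only [smul_mul_assoc, mul_smul_comm, smul_smul]
      rw [← sub_smul, ← Complex.ofReal_mul, ← Complex.ofReal_mul, hηη, Complex.ofReal_sub]
    have h0 : η t = 0 := by simp [hη, hψt]
    rw [e]
    exact mul_mem_kerSq (by simp [eval_apply, hq, h0]) (by simp [eval_apply, hq, h0])

/-- A trivialization e over V transports v to the field s ↦ e_s⁻¹(e_t v), which corresponds to a
constant map and so is continuous over V. -/
theorem exists_isLift_of_isLocallyTrivial (U : ContinuousField Ω A) (hU : U.IsLocallyTrivial)
    (t : Ω) : ∃ s, IsLift (U.eval t) s 3 := by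
  classical
  obtain ⟨V, hV, B, _, _, _, _, _, ⟨e⟩⟩ := hU t
  have ht : t ∈ V := mem_of_mem_nhds hV
  have hsymm : ∀ (s : V) (b c : B), (e.fibreMap s).symm (b * c)
      = (e.fibreMap s).symm b * (e.fibreMap s).symm c := fun s b c => by
    apply (e.fibreMap s).injective
    rw [e.map_mul]
    simp
  refine U.exists_isLift_of_transport (interior_mem_nhds.2 hV)
    -- The value 0 off V keeps the algebraic identities and the norm bound valid at every point;
    -- continuity is claimed only on the interior of V.
    (fun v s => if h : s ∈ V then (e.fibreMap ⟨s, h⟩).symm (e.fibreMap ⟨t, ht⟩ v) else 0)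
    (fun v => ?_) (fun v s => ?_) (fun v w s => ?_) (fun c v s => ?_) (fun v w s => ?_)
    (fun v s hs => ?_)
  · rw [dif_pos ht]
    exact (e.fibreMap ⟨t, ht⟩).symm_apply_apply v
  · split_ifs
    · rw [LinearIsometryEquiv.norm_map]
      exact ((e.fibreMap ⟨t, ht⟩).norm_map v).le
    · simp
  · split_ifs
    · exact (congrArg _ (map_add (e.fibreMap ⟨t, ht⟩) v w)).trans (map_add _ _ _)
    · simp
  · split_ifs
    · exact (congrArg _ (map_smul (e.fibreMap ⟨t, ht⟩) c v)).trans (map_smul _ _ _)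
    · simp
  · split_ifs with h
    · exact (congrArg _ (e.map_mul ⟨t, ht⟩ v w)).trans (hsymm ⟨s, h⟩ _ _)
    · simp
  · intro ε hε
    have hmem : (fun r : V => (e.fibreMap r).symm (e.fibreMap ⟨t, ht⟩ v))
        ∈ (U.restrict V).carrier := by
      rw [e.mem_iff]
      simp only [LinearIsometryEquiv.apply_symm_apply]
      exact continuous_const
    obtain ⟨x', hx', h⟩ := hmem ⟨s, interior_subset hs⟩ ε hε
    refine ⟨x', hx', ?_⟩
    -- At interior points, relative neighbourhoods in V are neighbourhoods in Ω.
    have hVs : V ∈ 𝓝 s := mem_interior_iff_mem_nhds.1 hs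
    rw [nhds_subtype_eq_comap, eventually_comap] at h
    filter_upwards [h, hVs] with r hr hrV
    rw [dif_pos hrV]
    exact hr ⟨r, hrV⟩ rfl

end LocallyTrivial

end ContinuousField

/-! ### Projectivity of the algebra of sections and of the fibres -/

/-- Supplies the approximation by single products from which `kerSq` is identified with the kernel
of evaluation. -/
theorem HasRightBoundedApproxId.exists_norm_sub_mul_lt {R : Type*} [NonUnitalNormedRing R]
    (h : HasRightBoundedApproxId R) (a : R) {ε : ℝ} (hε : 0 < ε) :
    ∃ x y : R, ‖a - x * y‖ < ε := by
  obtain ⟨l, hl, -, h⟩ := h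
  obtain ⟨e, he⟩ := (Metric.tendsto_nhds.1 (h a) ε hε).exists
  exact ⟨a, e, by rwa [dist_comm, dist_eq_norm] at he⟩

theorem HasLeftBoundedApproxId.exists_norm_sub_mul_lt {R : Type*} [NonUnitalNormedRing R]
    (h : HasLeftBoundedApproxId R) (a : R) {ε : ℝ} (hε : 0 < ε) :
    ∃ x y : R, ‖a - x * y‖ < ε := by
  obtain ⟨l, hl, -, h⟩ := h
  obtain ⟨e, he⟩ := (Metric.tendsto_nhds.1 (h a) ε hε).exists
  exact ⟨e, a, by rwa [dist_comm, dist_eq_norm] at he⟩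

/-- A Banach algebra that is not left projective has a nonzero second cohomology group and a
strongly unsplittable singular extension. -/
theorem exists_nontrivial_H2_and_unsplittable_of_not_left {R : Type u} [NonUnitalNormedRing R]
    [NormedSpace ℂ R] [IsScalarTower ℂ R R] [SMulCommClass ℂ R R] [CompleteSpace R]
    (hR : ∀ ρ : R →L[ℂ] ProjTensor (AdjoinOne R) R, ¬ IsLeftProjectiveSection ρ) :
    (∃ (X : Type u) (_ : NormedAddCommGroup X) (_ : NormedSpace ℂ X) (_ : CompleteSpace X)
      (M : BanachBimodule R X), Nontrivial M.H2) ∧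
    (∃ (B : Type u) (_ : NonUnitalNormedRing B) (_ : NormedSpace ℂ B)
      (_ : IsScalarTower ℂ B B) (_ : SMulCommClass ℂ B B) (_ : CompleteSpace B)
      (π : B →ₙₐ[ℂ] R), IsSingularExtension π ∧ ¬ SplitsStrongly π) := by
  have h : ¬ ∃ ρ : R →L[ℂ] ProjTensor (AdjoinOne R) R,
      (∀ a b, ρ (a * b) = (leftCover R).act a (ρ b)) ∧ ∀ b, (leftCover R).proj (ρ b) = b :=
    fun ⟨ρ, h₁, h₂⟩ => hR ρ ⟨h₁, h₂⟩
  exact ⟨⟨_, _, _, (leftCover R).proj.isClosed_ker.completeSpace_coe,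
    (leftCover R).kerBimodule, (leftCover R).nontrivial_H2 h⟩, (leftCover R).exists_unsplittable h⟩

/-- A Banach algebra that is not right projective has a nonzero second cohomology group and a
strongly unsplittable singular extension. -/
theorem exists_nontrivial_H2_and_unsplittable_of_not_right {R : Type u} [NonUnitalNormedRing R]
    [NormedSpace ℂ R] [IsScalarTower ℂ R R] [SMulCommClass ℂ R R] [CompleteSpace R]
    (hR : ∀ ρ : R →L[ℂ] ProjTensor R (AdjoinOne R), ¬ IsRightProjectiveSection ρ) :
    (∃ (X : Type u) (_ : NormedAddCommGroup X) (_ : NormedSpace ℂ X) (_ : CompleteSpace X)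
      (M : BanachBimodule R X), Nontrivial M.H2) ∧
    (∃ (B : Type u) (_ : NonUnitalNormedRing B) (_ : NormedSpace ℂ B)
      (_ : IsScalarTower ℂ B B) (_ : SMulCommClass ℂ B B) (_ : CompleteSpace B)
      (π : B →ₙₐ[ℂ] R), IsSingularExtension π ∧ ¬ SplitsStrongly π) := by
  have h : ¬ ∃ ρ : R →L[ℂ] ProjTensor R (AdjoinOne R),
      (∀ a b, ρ (a * b) = (rightCover R).act b (ρ a)) ∧ ∀ b, (rightCover R).proj (ρ b) = b :=
    fun ⟨ρ, h₁, h₂⟩ => hR ρ ⟨h₁, h₂⟩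
  exact ⟨⟨_, _, _, (rightCover R).proj.isClosed_ker.completeSpace_coe,
    (rightCover R).kerBimodule, (rightCover R).nontrivial_H2 h⟩,
    (rightCover R).exists_unsplittable h⟩

/-! ### From projectivity of the section algebra to uniform projectivity of the fibres -/

section Main

variable {Ω : Type u} [TopologicalSpace Ω] {A : Ω → Type v} [∀ t, NonUnitalNormedRing (A t)]
  [∀ t, NormedSpace ℂ (A t)] [∀ t, IsScalarTower ℂ (A t) (A t)]
  [∀ t, SMulCommClass ℂ (A t) (A t)] [∀ t, CompleteSpace (A t)] (U : ContinuousField Ω A)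

/-- Uniformity comes from the lifting constant being the same at all points: every descended section
has norm at most 3‖ρ‖. -/
theorem uniformlyLeftProjective_of_isLift (hs : ∀ t, ∃ s, IsLift (U.eval t) s 3)
    {ρ : U.Sections →L[ℂ] ProjTensor (AdjoinOne U.Sections) U.Sections}
    (hρ : IsLeftProjectiveSection ρ) : UniformlyLeftProjective A := by
  choose s hs using hs
  choose ρ' hρ' hn using fun t => hρ.exists_descend (U.norm_eval_le t) (U.eval_mul t)
    zero_le_three (hs t)
  exact ⟨ρ', hρ', ‖ρ‖ * 3, by rintro _ ⟨t, rfl⟩; exact hn t⟩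

theorem uniformlyRightProjective_of_isLift (hs : ∀ t, ∃ s, IsLift (U.eval t) s 3)
    {ρ : U.Sections →L[ℂ] ProjTensor U.Sections (AdjoinOne U.Sections)}
    (hρ : IsRightProjectiveSection ρ) : UniformlyRightProjective A := by
  choose s hs using hs
  choose ρ' hρ' hn using fun t => hρ.exists_descend (U.norm_eval_le t) (U.eval_mul t)
    zero_le_three (hs t)
  exact ⟨ρ', hρ', ‖ρ‖ * 3, by rintro _ ⟨t, rfl⟩; exact hn t⟩

end Main
end BanachFields
end

open BanachFields
theorem proposition3p6 {Ω : Type u} [TopologicalSpace Ω] [LocallyCompactSpace Ω] [T2Space Ω]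
    {A : Ω → Type v} [∀ t, NonUnitalNormedRing (A t)] [∀ t, NormedSpace ℂ (A t)]
    [∀ t, IsScalarTower ℂ (A t) (A t)] [∀ t, SMulCommClass ℂ (A t) (A t)]
    [∀ t, CompleteSpace (A t)] (U : ContinuousField Ω A)
    (hU : HasRightBoundedApproxId U.Sections ∨ HasLeftBoundedApproxId U.Sections ∨
      U.IsLocallyTrivial)
    (hA : ¬ UniformlyLeftProjective A ∨ ¬ UniformlyRightProjective A) :
    (∃ (X : Type max u v) (_ : NormedAddCommGroup X) (_ : NormedSpace ℂ X) (_ : CompleteSpace X)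
      (M : BanachBimodule U.Sections X), Nontrivial M.H2) ∧
    (∃ (B : Type max u v) (_ : NonUnitalNormedRing B) (_ : NormedSpace ℂ B)
      (_ : IsScalarTower ℂ B B) (_ : SMulCommClass ℂ B B) (_ : CompleteSpace B)
      (π : B →ₙₐ[ℂ] U.Sections), IsSingularExtension π ∧ ¬ SplitsStrongly π) := by
  have hs : ∀ t, ∃ s, IsLift (U.eval t) s 3 := by
    rcases hU with h | h | h
    · exact U.exists_isLift_of_products_dense fun a ε hε => h.exists_norm_sub_mul_lt a hε
    · exact U.exists_isLift_of_products_dense fun a ε hε => h.exists_norm_sub_mul_lt a hε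
    · exact U.exists_isLift_of_isLocallyTrivial h
  rcases hA with hA | hA
  · exact exists_nontrivial_H2_and_unsplittable_of_not_left fun ρ hρ =>
      hA (uniformlyLeftProjective_of_isLift U hs hρ)
  · exact exists_nontrivial_H2_and_unsplittable_of_not_right fun ρ hρ =>
      hA (uniformlyRightProjective_of_isLift U hs hρ)
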